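/- Let $(\Omega,\Sigma,\mathbb P)$ be a probability space and consider $$\inf_{x\in\mathbb R^n} f(x),\qquad f(x)=\mathbb E_s[g(x,s)-h(x,s)]+r_1(x)-r_2(x),$$ where $g(\cdot,s),h(\cdot,s)$ $(s\in\Omega)$ are finite continuous convex functions on $\mathbb R^n$ with $G(x)=\mathbb E_s[g(x,s)]$ and $H(x)=\mathbb E_s[h(x,s)]$ finite for all $x$, and $r_1,r_2:\mathbb R^n\to\mathbb R\cup\{+\infty\}$ are convex and lower semicontinuous (convention $(+\infty)-(+\infty)=+\infty$). A point $x$ is called critical if $0\in D(x):=\partial G(x)+\partial r_1(x)-\partial H(x)-\partial r_2(x)$, with the subdifferentials of convex analysis. The strong convexity modulus $\rho(\varphi)\in[0,+\infty]$ of $\varphi$ is the supremum of the $\rho\ge0$ such that $\varphi(\lambda x+(1-\lambda)y)\le\lambda\varphi(x)+(1-\lambda)\varphi(y)-\frac{\rho}{2}\lambda(1-\lambda)\|x-y\|^2$ for all $x,y$ and all $\lambda\in[0,1]$. **Weights.** Let $\alpha_k>0$, $A_k=\sum_{i=0}^k\alpha_i\to\infty$, $\beta_k=A_k/\big(\sum_{i=0}^k\alpha_i^2\big)^{1/2}$.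 Assume that $\sum_{k\ge1}\frac{\alpha_k(1+\sqrt{\ln\beta_{k-1}})}{\beta_{k-1}A_k}<\infty$ and that for some $N,\gamma>0$ one has $\sum_{i=0}^k\alpha_i^2/A_k^2\le N/k^\gamma$ for all $k\ge1$, where either $\gamma>1/2$ or $A_l/A_k\to1$ as $k,l\to\infty$ with $l/k\to1$. **Algorithms.** Start from $x^0$ with $r_1(x^0)<+\infty$. At step $k=0,1,\dots$ draw $s^k$ with law $\mathbb P$ (the $s^k$ are i.i.d., and $s^k$ is independent of $s^0,\dots,s^{k-1},x^0,\dots,x^k$), choose $z^k_i\in\partial h(\cdot,s^i)(x^k)$ for $i=0,\dots,k$ and $w^k\in\partial r_2(x^k)$, put $y^k=\frac1{A_k}\sum_{i=0}^k\alpha_iz^k_i$, and let $x^{k+1}$ be a minimizer over $\mathbb R^n$ of - (Algorithm 3) $x\mapsto G(x)+r_1(x)-\langle y^k+w^k,x\rangle$; - (Algorithm 4) $x\mapsto G_k(x)+r_1(x)-\langle y^k+w^k,x\rangle$, where $G_k(x)=\frac1{A_k}\sum_{i=0}^k\alpha_ig(x,s^i)$. **Theorem.** Let $(x^k)$ be generated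 by Algorithm 3 or by Algorithm 4. For Algorithm 3 assume (A1): for each $x$, $h(x,\cdot)$ is bounded on $\Omega$ and the family $\{h(\cdot,s)\}_{s\in\Omega}$ is equicontinuous at $x$. For Algorithm 4 assume (A2): the same for both $g$ and $h$. Assume that $\inf f$ is finite, that almost surely $(x^k)$ is bounded, and that $\inf_{s\in\Omega}\rho(h(\cdot,s))+\rho(r_2)>0$. Then: (i) Almost surely $f(x^k)$ converges to a finite limit and $\sum_{k=0}^\infty\|x^{k+1}-x^k\|^2<\infty$. Moreover, for almost every outcome for which the sequence $(w^k)$ is bounded, every limit point of $(x^k)$ is critical. In particular, if $(w^k)$ is almost surely bounded, then almost surely every limit point of $(x^k)$ is critical. (ii) Let $C$ be a compact set which almost surely contains all $x^k$, and suppose that $r_2$, the functions $h(\cdot,s)$ and, for Algorithm 4, also the functions $g(\cdot,s)$ $(s\in\Omega)$ are differentiable at the points of $C$ with gradients that are Lipschitz on $C$ with a common modulus $L/2$. Let $d_k=\min_{1\le i\le k}\mathbb E\big[d(0,D(x^i))\big]$. Then, as $k\to\infty$, $$d_k^2=O\Big(\frac1k\sum_{i=1}^k\frac{(1+\sqrt{\ln\beta_{i-1}})^2}{\beta_{i-1}^2}\Big),$$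 and if $\alpha_k=1$ for all $k$, then $d_k=O(\ln k/\sqrt k)$. -/

import Mathlib

open MeasureTheory ProbabilityTheory Filter Topology
open scoped NNReal ENNReal Pointwise

noncomputable section

namespace SDC

/-- The Euclidean space `ℝⁿ`. -/
abbrev E (n : ℕ) := EuclideanSpace ℝ (Fin n)

/-! Convex analysis for extended-real-valued functions. -/

/-- `ρ`-convexity of an extended-real-valued function (`ρ = 0` is convexity). -/
def RhoConvex {n : ℕ} (ρ : ℝ≥0) (φ : E n → EReal) : Prop :=
  ∀ x y : E n, ∀ t : ℝ, 0 ≤ t → t ≤ 1 →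
    φ (t • x + (1 - t) • y) ≤
      (t : EReal) * φ x + ((1 - t : ℝ) : EReal) * φ y
        - (((ρ : ℝ) / 2 * t * (1 - t) * ‖x - y‖ ^ 2 : ℝ) : EReal)

/-- The strong convexity modulus: the supremum of all `ρ ≥ 0` for which `φ` is `ρ`-convex. -/
def strongConvexityModulus {n : ℕ} (φ : E n → EReal) : ℝ≥0∞ :=
  ⨆ (ρ : ℝ≥0) (_ : RhoConvex ρ φ), (ρ : ℝ≥0∞)

/-- The subdifferential of convex analysis; it is empty outside the effective domain. -/
def subdiff {n : ℕ} (φ : E n → EReal) (x : E n) : Set (E n) :=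
  {v | φ x ≠ ⊤ ∧ ∀ y : E n, φ x + ((inner ℝ v (y - x) : ℝ) : EReal) ≤ φ y}

/-- A real-valued function, seen as an extended-real-valued one. -/
def ext {n : ℕ} (φ : E n → ℝ) : E n → EReal := fun x => (φ x : EReal)

/-- `φ` is finite near, and differentiable at, every point of `C`, and its gradient is Lipschitz
on `C` with modulus `K`. -/
def HasLipschitzGradientOn {n : ℕ} (φ : E n → EReal) (K : ℝ≥0) (C : Set (E n)) : Prop :=
  (∀ x ∈ C, (∀ᶠ y in 𝓝 x, φ y ≠ ⊤ ∧ φ y ≠ ⊥) ∧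
    DifferentiableAt ℝ (fun y => (φ y).toReal) x) ∧
  LipschitzOnWith K (gradient fun y => (φ y).toReal) C

/-- For each `x` the function `u x` is bounded on `Ω`, and the functions `u · s`, `s ∈ Ω`, are
equi-continuous at each `x`. -/
def BoundedEquicontinuous {n : ℕ} {Ω : Type*} (u : E n → Ω → ℝ) : Prop :=
  (∀ x : E n, ∃ M : ℝ, ∀ s : Ω, |u x s| ≤ M) ∧
  (∀ x : E n, ∀ ε > 0, ∃ δ > 0, ∀ y ∈ Metric.ball x δ, ∀ s : Ω, |u y s - u x s| ≤ ε)

/-! The weights. -/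

/-- `A_k = α_0 + ... + α_k`. -/
def weightSum (a : ℕ → ℝ) (k : ℕ) : ℝ := ∑ i ∈ Finset.range (k + 1), a i

/-- `β_k = A_k / (α_0² + ... + α_k²)^{1/2}`. -/
def beta (a : ℕ → ℝ) (k : ℕ) : ℝ :=
  weightSum a k / Real.sqrt (∑ i ∈ Finset.range (k + 1), a i ^ 2)

/-- The weighted average `(1 / A_k) ∑_{i ≤ k} α_i v_i`. -/
def weightedAvg {V : Type*} [AddCommGroup V] [Module ℝ V] (a : ℕ → ℝ) (k : ℕ) (v : ℕ → V) : V :=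
  (weightSum a k)⁻¹ • ∑ i ∈ Finset.range (k + 1), a i • v i

/-- The conditions on the weights. In the last one the limit is along pairs `(k, l)` with
`k, l → ∞` and `l / k → 1`. -/
structure AdmissibleWeights (a : ℕ → ℝ) : Prop where
  pos : ∀ k, 0 < a k
  sum_infinite : Tendsto (weightSum a) atTop atTop
  summable : Summable fun k : ℕ =>
    a (k + 1) * (1 + Real.sqrt (Real.log (beta a k))) / (beta a k * weightSum a (k + 1))
  decay : ∃ N γ : ℝ, 0 < N ∧ 0 < γ ∧
    (∀ k : ℕ, 1 ≤ k →
      (∑ i ∈ Finset.range (k + 1), a i ^ 2) / weightSum a k ^ 2 ≤ N / (k : ℝ) ^ γ) ∧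
    (1 / 2 < γ ∨
      Tendsto (fun q : ℕ × ℕ => weightSum a q.2 / weightSum a q.1)
        (atTop ⊓ comap (fun q : ℕ × ℕ => (q.2 : ℝ) / (q.1 : ℝ)) (𝓝 1)) (𝓝 1))

/-! The stochastic DC program. -/

/-- The data of a stochastic DC program on `ℝⁿ` with sample space `(Ω, P)`, with the standing
assumptions. -/
structure Program (n : ℕ) {Ω : Type*} [MeasurableSpace Ω] (P : Measure Ω) where
  g : E n → Ω → ℝ
  h : E n → Ω → ℝ
  r₁ : E n → EReal
  r₂ : E n → EReal
  g_convex : ∀ s, ConvexOn ℝ Set.univ fun x => g x s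
  h_convex : ∀ s, ConvexOn ℝ Set.univ fun x => h x s
  g_continuous : ∀ s, Continuous fun x => g x s
  h_continuous : ∀ s, Continuous fun x => h x s
  g_integrable : ∀ x, Integrable (g x) P
  h_integrable : ∀ x, Integrable (h x) P
  r₁_ne_bot : ∀ x, r₁ x ≠ ⊥
  r₂_ne_bot : ∀ x, r₂ x ≠ ⊥
  r₁_convex : RhoConvex 0 r₁
  r₂_convex : RhoConvex 0 r₂
  r₁_lsc : LowerSemicontinuous r₁
  r₂_lsc : LowerSemicontinuous r₂

/-- The two schemes, which differ in how the first DC component enters the subproblem. -/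
inductive Scheme where
  | sdca3
  | sdca4

namespace Program

variable {n : ℕ} {Ω : Type*} [MeasurableSpace Ω] {P : Measure Ω} (p : Program n P)

/-- `G(x) = 𝔼 g(x, s)`. -/
def G (x : E n) : ℝ := ∫ s, p.g x s ∂P

/-- `H(x) = 𝔼 h(x, s)`. -/
def H (x : E n) : ℝ := ∫ s, p.h x s ∂P

open Classical in
/-- The objective `f = 𝔼 [g(·, s) - h(·, s)] + r₁ - r₂`, with the convention
`(+∞) - (+∞) = +∞`. -/
def objective (x : E n) : EReal :=
  if p.r₁ x = ⊤ then ⊤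
  else ((∫ s, (p.g x s - p.h x s) ∂P : ℝ) : EReal) + (p.r₁ x - p.r₂ x)

/-- The optimal value is finite. -/
def FiniteOptimalValue : Prop := ∃ α : ℝ, ⨅ x, p.objective x = (α : EReal)

/-- The set `∂G(x) + ∂r₁(x) - ∂H(x) - ∂r₂(x)`. -/
def residual (x : E n) : Set (E n) :=
  subdiff (ext p.G) x + subdiff p.r₁ x - subdiff (ext p.H) x - subdiff p.r₂ x

/-- (DC) critical points. -/
def IsCritical (x : E n) : Prop := (0 : E n) ∈ p.residual x

/-- `ρ = inf_s ρ(h(·, s)) + ρ(r₂)`. -/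
def modulus : ℝ≥0∞ :=
  (⨅ s : Ω, strongConvexityModulus (ext fun x => p.h x s)) + strongConvexityModulus p.r₂

/-- Assumption (A1) for the first scheme and (A2) for the second. -/
def Regular : Scheme → Prop
  | .sdca3 => BoundedEquicontinuous p.h
  | .sdca4 => BoundedEquicontinuous p.g ∧ BoundedEquicontinuous p.h

/-- The first DC component used at step `k` for the samples `σ 0, ..., σ k`: it is `G` for the
first scheme and the weighted sample average `G_k` for the second. -/
def firstComponent (a : ℕ → ℝ) (σ : ℕ → Ω) (k : ℕ) : Scheme → E n → ℝ
  | .sdca3 => p.G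
  | .sdca4 => fun v => weightedAvg a k fun i => p.g v (σ i)

/-- The gradients of `r₂`, of the `h(·, s)` and, for the second scheme, of the `g(·, s)` are
Lipschitz on `C` with the common modulus `L / 2`. -/
def EquiLipschitzGradients (L : ℝ≥0) (C : Set (E n)) : Scheme → Prop
  | .sdca3 => HasLipschitzGradientOn p.r₂ (L / 2) C ∧
      ∀ s, HasLipschitzGradientOn (ext fun x => p.h x s) (L / 2) C
  | .sdca4 => HasLipschitzGradientOn p.r₂ (L / 2) C ∧
      (∀ s, HasLipschitzGradientOn (ext fun x => p.h x s) (L / 2) C) ∧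
      ∀ s, HasLipschitzGradientOn (ext fun x => p.g x s) (L / 2) C

end Program

/-- The σ-algebra generated by `s⁰, ..., s^{k-1}` and `x⁰, ..., x^k`. -/
abbrev history {n : ℕ} {Ω Ω' : Type*} [MeasurableSpace Ω]
    (s : ℕ → Ω' → Ω) (x : ℕ → Ω' → E n) (k : ℕ) : MeasurableSpace Ω' :=
  (⨆ i : ℕ, ⨆ _ : i < k, MeasurableSpace.comap (s i) inferInstance) ⊔
    ⨆ i : ℕ, ⨆ _ : i ≤ k, MeasurableSpace.comap (x i) inferInstance

/-- `x` is a sequence of iterates generated by the given scheme on the probability space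
`(Ω', μ)`, from the starting point `x₀`, with samples `s`, subgradients
`z k i ∈ ∂h(·, sⁱ)(x^k)` for `i ≤ k`, and `w k ∈ ∂r₂(x^k)`. The samples are independent with law
`P`, and each sample `s^k` is drawn independently of the past samples and of the iterates
`x⁰, ..., x^k` already computed. -/
structure IsRun {n : ℕ} {Ω : Type*} [MeasurableSpace Ω] {P : Measure Ω} (p : Program n P)
    (alg : Scheme) (a : ℕ → ℝ) {Ω' : Type*} [MeasurableSpace Ω'] (μ : Measure Ω')
    (x₀ : E n) (s : ℕ → Ω' → Ω) (x : ℕ → Ω' → E n)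
    (z : ℕ → ℕ → Ω' → E n) (w : ℕ → Ω' → E n) : Prop where
  sample_measurable : ∀ k, Measurable (s k)
  sample_law : ∀ k, μ.map (s k) = P
  sample_indep : iIndepFun s μ
  iterate_measurable : ∀ k, Measurable (x k)
  sample_fresh : ∀ k, Indep (MeasurableSpace.comap (s k) inferInstance) (history s x k) μ
  start_mem : p.r₁ x₀ ≠ ⊤
  start_eq : ∀ ω, x 0 ω = x₀
  z_mem : ∀ᵐ ω ∂μ, ∀ k i : ℕ, i ≤ k →
    z k i ω ∈ subdiff (ext fun v => p.h v (s i ω)) (x k ω)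
  w_mem : ∀ᵐ ω ∂μ, ∀ k : ℕ, w k ω ∈ subdiff p.r₂ (x k ω)
  step : ∀ᵐ ω ∂μ, ∀ k : ℕ,
    IsMinOn (fun v : E n =>
      ((p.firstComponent a (fun i => s i ω) k alg v : ℝ) : EReal) + p.r₁ v
        - ((inner ℝ (weightedAvg a k (fun i => z k i ω) + w k ω) v : ℝ) : EReal))
      Set.univ (x (k + 1) ω)

/-- `d_k = min_{1 ≤ i ≤ k} 𝔼 d(0, ∂G(xⁱ) + ∂r₁(xⁱ) - ∂H(xⁱ) - ∂r₂(xⁱ))`, where the distance to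
the empty set is `+∞`. -/
def criticalityGap {n : ℕ} {Ω : Type*} [MeasurableSpace Ω] {P : Measure Ω} (p : Program n P)
    {Ω' : Type*} [MeasurableSpace Ω'] (μ : Measure Ω') (x : ℕ → Ω' → E n) (k : ℕ) : ℝ≥0∞ :=
  ⨅ i ∈ Finset.Icc 1 k, ∫⁻ ω, Metric.infEDist 0 (p.residual (x i ω)) ∂μ

end SDC

end

/-!
Averaging the samples turns `f` into a surrogate objective, and the minimality of the new iterate
together with strong convexity makes the surrogate decrease along the run by a multiple of
`‖x (k + 1) - x k‖ ^ 2`, up to the effect of replacing the average over `k + 1` samples by the one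
over `k + 2` samples. That effect is `α_{k+1} / A_{k+1}` times the difference between an error made
with the fresh sample, whose sum is an `L²`-bounded martingale, and the sampling error at step `k`.

The sampling errors are controlled uniformly on bounded sets. Hoeffding's inequality at the
`(1 + 2Rβ_k)ⁿ` points of a `1 / β_k`-net, together with local Lipschitz continuity of the convex
functions, bounds the expected supremum by a multiple of `(1 + √(ln β_k)) / β_k`, so the weighted
errors are summable; almost sure uniform convergence follows from the decay condition via
Borel–Cantelli and the equicontinuity. Hence the surrogate values converge and the squared steps
are summable, and the optimality condition of the subproblem passes to the limit.

For smooth data the optimality condition of the subproblem exhibits an element of the residual at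
`x (k + 1)` whose norm is at most the sampling error of the gradients plus
`L ‖x (k + 1) - x k‖`, and averaging the squares over `k` gives the rate.
-/

noncomputable section

namespace SDC

section Sandwich

variable {F : Type*} [AddCommGroup F] [TopologicalSpace F] [IsTopologicalAddGroup F] [Module ℝ F]
  [ContinuousSMul ℝ F]

lemma exists_affine_between_of_concaveOn_le_convexOn {φ ψ : F → ℝ} {D : Set F}
    (hφ : ConvexOn ℝ Set.univ φ) (hφc : Continuous φ) (hψ : ConcaveOn ℝ D ψ) (hD : D.Nonempty)
    (hle : ∀ y ∈ D, ψ y ≤ φ y) :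
    ∃ (ℓ : StrongDual ℝ F) (c : ℝ), (∀ y, ℓ y + c ≤ φ y) ∧ ∀ y ∈ D, ψ y ≤ ℓ y + c := by
  have hdisj : Disjoint {q : F × ℝ | q.1 ∈ Set.univ ∧ φ q.1 < q.2} {q | q.1 ∈ D ∧ q.2 ≤ ψ q.1} :=
    Set.disjoint_left.2 fun q hq hq' => (hq.2.trans_le hq'.2).not_ge (hle _ hq'.1)
  have hopen : IsOpen {q : F × ℝ | q.1 ∈ Set.univ ∧ φ q.1 < q.2} := by
    simpa using isOpen_lt (hφc.comp continuous_fst) continuous_snd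
  obtain ⟨f, c, habove, hbelow⟩ := geometric_hahn_banach_open hφ.convex_strict_epigraph hopen
    hψ.convex_hypograph hdisj
  set τ : ℝ := -f (0, 1)
  have hf (y : F) (t : ℝ) : f (y, t) = f (y, 0) - τ * t := by
    have : ((y, t) : F × ℝ) = (y, 0) + t • (0, 1) := by simp
    rw [this, map_add, map_smul, smul_eq_mul]
    ring
  have hτ : 0 < τ := by
    obtain ⟨y, hy⟩ := hD
    have h₁ := habove (y, φ y + 1) ⟨trivial, by simp⟩
    have h₂ := hbelow (y, ψ y) ⟨hy, le_rfl⟩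
    rw [hf] at h₁ h₂
    nlinarith [hle y hy]
  refine ⟨τ⁻¹ • f.comp (ContinuousLinearMap.inl ℝ F ℝ), -(τ⁻¹ * c), fun y => ?_, fun y hy => ?_⟩
  · refine le_of_forall_gt_imp_ge_of_dense fun t ht => ?_
    have h := (habove (y, t) ⟨trivial, ht⟩).le
    rw [hf] at h
    calc τ⁻¹ * f (y, 0) + -(τ⁻¹ * c) = τ⁻¹ * (f (y, 0) - c) := by ring
      _ ≤ t := by rw [inv_mul_le_iff₀ hτ]; linarith
  · have h := hbelow (y, ψ y) ⟨hy, le_rfl⟩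
    rw [hf] at h
    calc ψ y ≤ τ⁻¹ * (f (y, 0) - c) := by rw [le_inv_mul_iff₀ hτ]; linarith
      _ = τ⁻¹ * f (y, 0) + -(τ⁻¹ * c) := by ring

end Sandwich

section StrongConvexity

variable {F : Type*} [NormedAddCommGroup F] [NormedSpace ℝ F]

lemma add_sq_le_of_strongConvexOn {D : Set F} {m : ℝ} {φ : F → ℝ} (hφ : StrongConvexOn D m φ)
    {x y : F} (hx : x ∈ D) (hy : y ∈ D) {ℓ : F →ₗ[ℝ] ℝ}
    (hℓ : ∀ y ∈ D, φ x + ℓ (y - x) ≤ φ y) :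
    φ x + ℓ (y - x) + m / 2 * ‖y - x‖ ^ 2 ≤ φ y := by
  have hsegment : ∀ t ∈ Set.Ioo (0 : ℝ) 1,
      φ x + ℓ (y - x) + m / 2 * ‖y - x‖ ^ 2 * (1 - t) ≤ φ y := by
    rintro t ⟨h₀, h₁⟩
    have hconv := hφ.2 hy hx h₀.le (sub_nonneg.2 h₁.le) (by ring)
    have hsub := hℓ _ (hφ.1 hy hx h₀.le (sub_nonneg.2 h₁.le) (by ring))
    rw [show t • y + (1 - t) • x - x = t • (y - x) by module, map_smul] at hsub
    simp only [smul_eq_mul] at hconv hsub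
    refine le_of_mul_le_mul_left ?_ h₀
    linarith
  have hlim : Tendsto (fun t : ℝ => φ x + ℓ (y - x) + m / 2 * ‖y - x‖ ^ 2 * (1 - t)) (𝓝[>] 0)
      (𝓝 (φ x + ℓ (y - x) + m / 2 * ‖y - x‖ ^ 2)) :=
    (Continuous.tendsto' (by fun_prop) _ _ (by simp)).mono_left nhdsWithin_le_nhds
  exact le_of_tendsto hlim (eventually_of_mem (Ioo_mem_nhdsGT one_pos) hsegment)

end StrongConvexity

section Subdifferential

variable {n : ℕ} {φ : E n → EReal} {ψ : E n → ℝ} {ρ ρ' : ℝ≥0} {x y v : E n}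

lemma ext_ne_bot (ψ : E n → ℝ) (x : E n) : ext ψ x ≠ ⊥ := EReal.coe_ne_bot _

lemma mem_subdiff_iff (hφ : ∀ x, φ x ≠ ⊥) :
    v ∈ subdiff φ x ↔ φ x ≠ ⊤ ∧
      ∀ y, φ y ≠ ⊤ → (φ x).toReal + inner ℝ v (y - x) ≤ (φ y).toReal := by
  refine and_congr_right fun hx => forall_congr' fun y => ?_
  by_cases hy : φ y = ⊤
  · simp [hy]
  · rw [imp_iff_right hy, ← EReal.coe_le_coe_iff, EReal.coe_add, EReal.coe_toReal hx (hφ x),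
      EReal.coe_toReal hy (hφ y)]

lemma mem_subdiff_ext_iff : v ∈ subdiff (ext ψ) x ↔ ∀ y, ψ x + inner ℝ v (y - x) ≤ ψ y := by
  simp [mem_subdiff_iff (ext_ne_bot ψ), ext]

lemma RhoConvex.strongConvexOn_toReal (h : RhoConvex ρ φ) (hφ : ∀ x, φ x ≠ ⊥) :
    StrongConvexOn {x | φ x ≠ ⊤} ρ fun x => (φ x).toReal := by
  have hle {x y : E n} (hx : φ x ≠ ⊤) (hy : φ y ≠ ⊤) {s t : ℝ} (hs : 0 ≤ s) (ht : 0 ≤ t)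
      (hst : s + t = 1) : φ (s • x + t • y) ≤
        ((s * (φ x).toReal + t * (φ y).toReal - s * t * (ρ / 2 * ‖x - y‖ ^ 2) : ℝ) : EReal) := by
    obtain rfl : t = 1 - s := by linarith
    have := h x y s hs (by linarith)
    rw [← EReal.coe_toReal hx (hφ x), ← EReal.coe_toReal hy (hφ y)] at this
    refine this.trans (le_of_eq ?_)
    norm_cast
    ring
  have hfin {x y : E n} (hx : φ x ≠ ⊤) (hy : φ y ≠ ⊤) {s t : ℝ} (hs : 0 ≤ s) (ht : 0 ≤ t)
      (hst : s + t = 1) : φ (s • x + t • y) ≠ ⊤ :=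
    ((hle hx hy hs ht hst).trans_lt (EReal.coe_lt_top _)).ne
  refine ⟨fun x hx y hy s t hs ht hst => hfin hx hy hs ht hst,
    fun x hx y hy s t hs ht hst => ?_⟩
  have := hle hx hy hs ht hst
  rwa [← EReal.coe_toReal (hfin hx hy hs ht hst) (hφ _), EReal.coe_le_coe_iff] at this

lemma RhoConvex.convexOn_toReal (h : RhoConvex 0 φ) (hφ : ∀ x, φ x ≠ ⊥) :
    ConvexOn ℝ {x | φ x ≠ ⊤} fun x => (φ x).toReal := by
  simpa using h.strongConvexOn_toReal hφ

lemma RhoConvex.anti (h : RhoConvex ρ φ) (hle : ρ' ≤ ρ) : RhoConvex ρ' φ := by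
  intro x y t h₀ h₁
  refine (h x y t h₀ h₁).trans (EReal.sub_le_sub le_rfl (EReal.coe_le_coe ?_))
  have := sub_nonneg.2 h₁
  gcongr

lemma rhoConvex_of_lt_strongConvexityModulus (h : (ρ : ℝ≥0∞) < strongConvexityModulus φ) :
    RhoConvex ρ φ := by
  simp only [strongConvexityModulus, lt_iSup_iff] at h
  obtain ⟨ρ', hρ', hlt⟩ := h
  exact hρ'.anti (by exact_mod_cast hlt.le)

lemma RhoConvex.add_sq_le (h : RhoConvex ρ φ) (hφ : ∀ x, φ x ≠ ⊥) (hv : v ∈ subdiff φ x)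
    (hy : φ y ≠ ⊤) :
    (φ x).toReal + inner ℝ v (y - x) + ρ / 2 * ‖y - x‖ ^ 2 ≤ (φ y).toReal := by
  obtain ⟨hx, hv⟩ := (mem_subdiff_iff hφ).1 hv
  exact add_sq_le_of_strongConvexOn (h.strongConvexOn_toReal hφ) hx hy (ℓ := innerₗ (E n) v) hv

lemma RhoConvex.add_sq_le_of_ext (h : RhoConvex ρ (ext ψ)) (hv : v ∈ subdiff (ext ψ) x)
    (y : E n) : ψ x + inner ℝ v (y - x) + ρ / 2 * ‖y - x‖ ^ 2 ≤ ψ y :=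
  h.add_sq_le (ext_ne_bot ψ) hv (EReal.coe_ne_top (ψ y))

/-- Moreau–Rockafellar: an affine function between `ψ` and the concave function
`ψ x + ⟪v, · - x⟫ + φ x - φ` provides the splitting of `v`. -/
lemma exists_add_mem_subdiff (hψ : ConvexOn ℝ Set.univ ψ) (hψc : Continuous ψ)
    (hφ : ∀ x, φ x ≠ ⊥) (hφc : RhoConvex 0 φ) (hx : φ x ≠ ⊤)
    (hv : ∀ y, φ y ≠ ⊤ → ψ x + (φ x).toReal + inner ℝ v (y - x) ≤ ψ y + (φ y).toReal) :
    ∃ u₁ ∈ subdiff (ext ψ) x, ∃ u₂ ∈ subdiff φ x, u₁ + u₂ = v := by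
  have hconc : ConcaveOn ℝ {y | φ y ≠ ⊤}
      ((fun y => inner ℝ v y + (ψ x + (φ x).toReal - inner ℝ v x)) - fun y => (φ y).toReal) :=
    (((innerₗ (E n) v).concaveOn (hφc.convexOn_toReal hφ).1).add_const _).sub
      (hφc.convexOn_toReal hφ)
  obtain ⟨ℓ, c, hℓψ, hℓφ⟩ := exists_affine_between_of_concaveOn_le_convexOn hψ hψc hconc ⟨x, hx⟩
    fun y hy => by
      have := hv y hy
      simp only [Pi.sub_apply]
      rw [inner_sub_right] at this
      linarith
  simp only [Pi.sub_apply] at hℓφ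
  have htouch : ℓ x + c = ψ x := by linarith [hℓψ x, hℓφ x hx]
  set u := (InnerProductSpace.toDual ℝ (E n)).symm ℓ
  have hu (y : E n) : inner ℝ u (y - x) = ℓ y - ℓ x := by simp [u]
  refine ⟨u, mem_subdiff_ext_iff.2 fun y => ?_, v - u, (mem_subdiff_iff hφ).2 ⟨hx, fun y hy => ?_⟩,
    add_sub_cancel u v⟩
  · linarith [hu y, hℓψ y]
  · rw [inner_sub_left, hu, inner_sub_right]
    linarith [hℓφ y hy]

lemma exists_mem_subdiff_ext (hψ : ConvexOn ℝ Set.univ ψ) (hψc : Continuous ψ) (x : E n) :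
    ∃ v, v ∈ subdiff (ext ψ) x := by
  obtain ⟨ℓ, c, hℓ, hx⟩ := exists_affine_between_of_concaveOn_le_convexOn hψ hψc
    (concaveOn_const (ψ x) (convex_singleton x)) ⟨x, rfl⟩ (by simp)
  refine ⟨(InnerProductSpace.toDual ℝ (E n)).symm ℓ, mem_subdiff_ext_iff.2 fun y => ?_⟩
  simp only [InnerProductSpace.toDual_symm_apply, map_sub]
  linarith [hℓ y, hx x rfl]

lemma norm_le_of_mem_subdiff_ext {M : ℝ} (hv : v ∈ subdiff (ext ψ) x)
    (hM : ∀ y ∈ Metric.closedBall x 1, |ψ y| ≤ M) : ‖v‖ ≤ 2 * M := by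
  have hx := abs_le.1 (hM x (Metric.mem_closedBall_self zero_le_one))
  rcases eq_or_ne v 0 with rfl | hv0
  · rw [norm_zero]
    linarith
  · set y := x + ‖v‖⁻¹ • v
    have hy : y - x = ‖v‖⁻¹ • v := add_sub_cancel_left _ _
    have hyM := abs_le.1 (hM y (by
      rw [mem_closedBall_iff_norm, hy, norm_smul, norm_inv, norm_norm]
      exact inv_mul_le_one))
    have hinner : inner ℝ v (y - x) = ‖v‖ := by
      rw [hy, inner_smul_right, real_inner_self_eq_norm_mul_norm,
        inv_mul_cancel_left₀ (norm_ne_zero_iff.2 hv0)]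
    linarith [mem_subdiff_ext_iff.1 hv y]

lemma eq_gradient_of_mem_subdiff (hφ : ∀ x, φ x ≠ ⊥) (hv : v ∈ subdiff φ x)
    (hfin : ∀ᶠ y in 𝓝 x, φ y ≠ ⊤) (hd : DifferentiableAt ℝ (fun y => (φ y).toReal) x) :
    v = gradient (fun y => (φ y).toReal) x := by
  have hmin : IsLocalMin (fun y => (φ y).toReal - inner ℝ v y) x := by
    filter_upwards [hfin] with y hy
    have := ((mem_subdiff_iff hφ).1 hv).2 y hy
    rw [inner_sub_right] at this
    linarith
  have hzero := hmin.hasFDerivAt_eq_zero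
    (hd.hasGradientAt.hasFDerivAt.sub (innerSL ℝ v).hasFDerivAt)
  refine ((InnerProductSpace.toDual ℝ (E n)).injective ?_).symm
  exact sub_eq_zero.1 hzero

lemma HasLipschitzGradientOn.eq_gradient {K : ℝ≥0} {C : Set (E n)}
    (h : HasLipschitzGradientOn φ K C) (hφ : ∀ x, φ x ≠ ⊥) (hx : x ∈ C) (hv : v ∈ subdiff φ x) :
    v = gradient (fun y => (φ y).toReal) x :=
  eq_gradient_of_mem_subdiff hφ hv ((h.1 x hx).1.mono fun _ hy => hy.1) (h.1 x hx).2

lemma gradient_mem_subdiff_ext (hψ : ConvexOn ℝ Set.univ ψ) (hψc : Continuous ψ)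
    (hd : DifferentiableAt ℝ ψ x) : gradient ψ x ∈ subdiff (ext ψ) x := by
  obtain ⟨v, hv⟩ := exists_mem_subdiff_ext hψ hψc x
  have := eq_gradient_of_mem_subdiff (ext_ne_bot ψ) hv
    (Eventually.of_forall fun y => EReal.coe_ne_top (ψ y)) (by simpa [ext] using hd)
  simpa only [ext, EReal.toReal_coe, this] using hv

lemma ne_top_of_isMinOn (hφ : ∀ x, φ x ≠ ⊥)
    (hmin : IsMinOn (fun u => (ψ u : EReal) + φ u - (inner ℝ v u : ℝ)) Set.univ x)
    (hy : φ y ≠ ⊤) : φ x ≠ ⊤ := by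
  intro hx
  have := hmin (Set.mem_univ y)
  simp only [Set.mem_ofPred_eq, hx, EReal.coe_add_top, EReal.top_sub_coe, top_le_iff] at this
  rw [← EReal.coe_toReal hy (hφ y)] at this
  exact EReal.coe_ne_top _ (by exact_mod_cast this)

lemma add_inner_le_of_isMinOn (hφ : ∀ x, φ x ≠ ⊥)
    (hmin : IsMinOn (fun u => (ψ u : EReal) + φ u - (inner ℝ v u : ℝ)) Set.univ x)
    (hy : φ y ≠ ⊤) :
    ψ x + (φ x).toReal + inner ℝ v (y - x) ≤ ψ y + (φ y).toReal := by
  have := hmin (Set.mem_univ y)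
  simp only [Set.mem_ofPred_eq] at this
  rw [← EReal.coe_toReal (ne_top_of_isMinOn hφ hmin hy) (hφ x),
    ← EReal.coe_toReal hy (hφ y)] at this
  norm_cast at this
  rw [inner_sub_right]
  linarith

lemma ne_top_and_toReal_le_of_tendsto (hφ : ∀ x, φ x ≠ ⊥) (hlsc : LowerSemicontinuous φ)
    {ι : Type*} {l : Filter ι} [l.NeBot] {ξ : ι → E n} {t : ι → ℝ} {c : ℝ}
    (hξ : Tendsto ξ l (𝓝 y)) (ht : Tendsto t l (𝓝 c)) (hle : ∀ i, φ (ξ i) ≤ t i) :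
    φ y ≠ ⊤ ∧ (φ y).toReal ≤ c := by
  have hyc : φ y ≤ c :=
    hlsc.isClosed_epigraph.mem_of_tendsto
      (hξ.prodMk_nhds (continuous_coe_real_ereal.continuousAt.tendsto.comp ht))
      (Eventually.of_forall hle)
  have hy : φ y ≠ ⊤ := (hyc.trans_lt (EReal.coe_lt_top c)).ne
  exact ⟨hy, by rwa [← EReal.coe_le_coe_iff, EReal.coe_toReal hy (hφ y)]⟩

end Subdifferential

section BoundedEquicontinuous

variable {n : ℕ} {Ω : Type*} {u : E n → Ω → ℝ}

lemma BoundedEquicontinuous.exists_bound (hu : BoundedEquicontinuous u) {C : Set (E n)}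
    (hC : IsCompact C) : ∃ M : ℝ, ∀ x ∈ C, ∀ s, |u x s| ≤ M := by
  refine hC.induction_on ⟨0, by simp⟩ (fun _ _ hst ⟨M, hM⟩ => ⟨M, fun x hx => hM x (hst hx)⟩)
    ?_ fun x _ => ?_
  · rintro _ _ ⟨M, hM⟩ ⟨M', hM'⟩
    refine ⟨max M M', ?_⟩
    rintro x (hx | hx) s
    · exact (hM x hx s).trans (le_max_left _ _)
    · exact (hM' x hx s).trans (le_max_right _ _)
  · obtain ⟨M, hM⟩ := hu.1 x
    obtain ⟨δ, hδ, hnear⟩ := hu.2 x 1 one_pos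
    refine ⟨Metric.ball x δ, mem_nhdsWithin_of_mem_nhds (Metric.ball_mem_nhds x hδ), M + 1,
      fun y hy s => ?_⟩
    linarith [abs_add_le (u x s) (u y s - u x s), hnear y hy s, hM s,
      congrArg abs (add_sub_cancel (u x s) (u y s))]

lemma BoundedEquicontinuous.exists_lipschitz (hu : BoundedEquicontinuous u)
    (hc : ∀ s, ConvexOn ℝ Set.univ fun x => u x s) (R : ℝ) :
    ∃ Λ : ℝ≥0, ∀ s, LipschitzOnWith Λ (fun x => u x s) (Metric.closedBall 0 R) := by
  obtain ⟨M, hM⟩ := hu.exists_bound (isCompact_closedBall (0 : E n) (R + 2))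
  refine ⟨(2 * M / 1).toNNReal, fun s => ?_⟩
  have hlip : LipschitzOnWith (2 * M / 1).toNNReal (fun x => u x s)
      (Metric.ball 0 (R + 2 - 1)) :=
    ((hc s).subset (Set.subset_univ _) (convex_ball _ _)).lipschitzOnWith_of_abs_le one_pos
      fun y hy => hM y (Metric.ball_subset_closedBall hy) s
  exact hlip.mono (Metric.closedBall_subset_ball (by linarith))

end BoundedEquicontinuous

section Weights

variable {a : ℕ → ℝ}

lemma weightSum_succ (a : ℕ → ℝ) (k : ℕ) : weightSum a (k + 1) = weightSum a k + a (k + 1) :=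
  Finset.sum_range_succ _ _

lemma weightSum_pos (ha : ∀ k, 0 < a k) (k : ℕ) : 0 < weightSum a k :=
  Finset.sum_pos (fun i _ => ha i) ⟨0, by simp⟩

lemma sum_sq_pos (ha : ∀ k, 0 < a k) (k : ℕ) : 0 < ∑ i ∈ Finset.range (k + 1), a i ^ 2 :=
  Finset.sum_pos (fun i _ => pow_pos (ha i) 2) ⟨0, by simp⟩

lemma beta_sq (a : ℕ → ℝ) (k : ℕ) :
    beta a k ^ 2 = weightSum a k ^ 2 / ∑ i ∈ Finset.range (k + 1), a i ^ 2 := by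
  rw [beta, div_pow, Real.sq_sqrt (Finset.sum_nonneg fun i _ => sq_nonneg (a i))]

lemma one_le_beta (ha : ∀ k, 0 < a k) (k : ℕ) : 1 ≤ beta a k := by
  have h₀ : 0 ≤ beta a k := div_nonneg (weightSum_pos ha k).le (Real.sqrt_nonneg _)
  rw [← one_le_sq_iff₀ h₀, beta_sq, one_le_div (sum_sq_pos ha k)]
  exact Finset.sum_sq_le_sq_sum_of_nonneg fun i _ => (ha i).le

lemma beta_of_eq_one (h : ∀ k, a k = 1) (k : ℕ) : beta a k = Real.sqrt (k + 1) := by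
  simp [beta, weightSum, h, Real.div_sqrt]

section Module

variable {V : Type*} [AddCommGroup V] [Module ℝ V]

lemma weightedAvg_add (k : ℕ) (v v' : ℕ → V) :
    weightedAvg a k (fun i => v i + v' i) = weightedAvg a k v + weightedAvg a k v' := by
  simp [weightedAvg, smul_add, Finset.sum_add_distrib]

lemma weightedAvg_sub (k : ℕ) (v v' : ℕ → V) :
    weightedAvg a k (fun i => v i - v' i) = weightedAvg a k v - weightedAvg a k v' := by
  simp [weightedAvg, smul_sub, Finset.sum_sub_distrib]

lemma map_weightedAvg {W : Type*} [AddCommGroup W] [Module ℝ W] (ℓ : V →ₗ[ℝ] W) (k : ℕ)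
    (v : ℕ → V) : ℓ (weightedAvg a k v) = weightedAvg a k fun i => ℓ (v i) := by
  simp [weightedAvg, map_sum]

lemma weightedAvg_const (ha : ∀ k, 0 < a k) (k : ℕ) (v : V) : weightedAvg a k (fun _ => v) = v :=
  Finset.centerMass_const (weightSum_pos ha k).ne' v

lemma weightedAvg_mem (ha : ∀ k, 0 < a k) {k : ℕ} {v : ℕ → V} {D : Set V} (hD : Convex ℝ D)
    (hv : ∀ i ≤ k, v i ∈ D) : weightedAvg a k v ∈ D :=
  hD.centerMass_mem (fun i _ => (ha i).le) (weightSum_pos ha k)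
    fun i hi => hv i (Finset.mem_range_succ_iff.1 hi)

lemma weightedAvg_succ (ha : ∀ k, 0 < a k) (k : ℕ) (v : ℕ → V) :
    weightedAvg a (k + 1) v =
      weightedAvg a k v + (a (k + 1) / weightSum a (k + 1)) • (v (k + 1) - weightedAvg a k v) := by
  have hk := weightSum_pos ha k
  have hk' := weightSum_pos ha (k + 1)
  have hcancel : weightSum a k • weightedAvg a k v = ∑ i ∈ Finset.range (k + 1), a i • v i :=
    smul_inv_smul₀ hk.ne' _
  have hsplit : weightSum a (k + 1) • weightedAvg a (k + 1) v =
      weightSum a k • weightedAvg a k v + a (k + 1) • v (k + 1) := by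
    rw [hcancel, ← Finset.sum_range_succ]
    exact smul_inv_smul₀ hk'.ne' _
  rw [← smul_right_inj hk'.ne', hsplit, smul_add, smul_smul, mul_div_cancel₀ _ hk'.ne',
    weightSum_succ]
  module

end Module

lemma norm_weightedAvg_le {V : Type*} [SeminormedAddCommGroup V] [NormedSpace ℝ V]
    (ha : ∀ k, 0 < a k) {k : ℕ} {v : ℕ → V} {c : ℝ} (hv : ∀ i ≤ k, ‖v i‖ ≤ c) :
    ‖weightedAvg a k v‖ ≤ c := by
  simpa using weightedAvg_mem ha (convex_closedBall (0 : V) c) fun i hi => by simpa using hv i hi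

lemma weightedAvg_mono (ha : ∀ k, 0 < a k) {k : ℕ} {v v' : ℕ → ℝ} (h : ∀ i ≤ k, v i ≤ v' i) :
    weightedAvg a k v ≤ weightedAvg a k v' := by
  rw [← sub_nonneg, ← weightedAvg_sub]
  exact weightedAvg_mem ha (convex_Ici 0) fun i hi => sub_nonneg.2 (h i hi)

end Weights

section Net

variable {F : Type*} [NormedAddCommGroup F] [NormedSpace ℝ F] [FiniteDimensional ℝ F]
  {R : ℝ} {δ : ℝ≥0}

lemma card_le_of_isSeparated (hR : 0 ≤ R) (hδ : 0 < δ) {T : Finset F}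
    (hT : ↑T ⊆ Metric.closedBall (0 : F) R) (hsep : Metric.IsSeparated (δ : ℝ≥0∞) (T : Set F)) :
    (T.card : ℝ) ≤ (2 * R / δ + 1) ^ Module.finrank ℝ F := by
  borelize F
  let μ : Measure F := Measure.addHaar
  have hδ' : (0 : ℝ) < δ := hδ
  have hdisj : (T : Set F).PairwiseDisjoint fun x => Metric.ball x ((δ : ℝ) / 2) := by
    intro x hx y hy hxy
    refine Metric.ball_disjoint_ball ?_
    have hdist := (hsep hx hy hxy).le
    rw [edist_nndist, ENNReal.coe_le_coe] at hdist
    simpa using NNReal.coe_le_coe.2 hdist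
  have hsub : ⋃ x ∈ T, Metric.ball x ((δ : ℝ) / 2) ⊆ Metric.ball 0 (R + δ / 2) :=
    Set.iUnion₂_subset fun x hx => Metric.ball_subset_ball' <| by
      linarith [Metric.mem_closedBall.1 (hT hx)]
  have hvol : (T.card : ℝ≥0∞) * ENNReal.ofReal (((δ : ℝ) / 2) ^ Module.finrank ℝ F)
      ≤ ENNReal.ofReal ((R + δ / 2) ^ Module.finrank ℝ F) := by
    have hmeas := measure_mono (μ := μ) hsub
    rw [measure_biUnion_finset hdisj fun _ _ => measurableSet_ball,
      Measure.addHaar_ball_of_pos μ _ (by positivity)] at hmeas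
    simp only [Measure.addHaar_ball_of_pos μ _ (half_pos hδ'), Finset.sum_const,
      nsmul_eq_mul, ← mul_assoc] at hmeas
    exact (ENNReal.mul_le_mul_iff_left (Metric.measure_ball_pos μ 0 one_pos).ne'
      measure_ball_lt_top.ne).1 hmeas
  rw [← ENNReal.ofReal_natCast, ← ENNReal.ofReal_mul (by positivity),
    ENNReal.ofReal_le_ofReal_iff (by positivity), ← le_div_iff₀ (by positivity),
    ← div_pow] at hvol
  rwa [show (R + δ / 2) / ((δ : ℝ) / 2) = 2 * R / δ + 1 by field_simp] at hvol

lemma exists_net (hR : 0 ≤ R) (hδ : 0 < δ) {C : Set F} (hC : C ⊆ Metric.closedBall 0 R) :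
    ∃ T : Finset F, ↑T ⊆ C ∧ Metric.IsCover δ C (T : Set F) ∧
      (T.card : ℝ) ≤ (2 * R / δ + 1) ^ Module.finrank ℝ F := by
  have hpack : Metric.packingNumber δ C ≠ ⊤ := by
    have hbdd : TotallyBounded C :=
      (isCompact_closedBall (0 : F) R).totallyBounded.subset hC
    obtain ⟨N, -, hN, hcover⟩ :=
      Metric.exists_finite_isCover_of_totallyBounded (half_pos hδ).ne' hbdd
    have hle := (Metric.packingNumber_two_mul_le_externalCoveringNumber (δ / 2) C).trans
      hcover.externalCoveringNumber_le_encard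
    rw [mul_div_cancel₀ δ two_ne_zero] at hle
    exact ne_top_of_le_ne_top hN.encard_lt_top.ne hle
  have hfin : (Metric.maximalSeparatedSet δ C).Finite := by
    rw [← Set.encard_ne_top_iff, Metric.encard_maximalSeparatedSet hpack]
    exact hpack
  refine ⟨hfin.toFinset, ?_, ?_, card_le_of_isSeparated hR hδ ?_ ?_⟩ <;>
    rw [hfin.coe_toFinset]
  · exact Metric.maximalSeparatedSet_subset
  · exact Metric.isCover_maximalSeparatedSet hpack
  · exact Metric.maximalSeparatedSet_subset.trans hC
  · exact Metric.isSeparated_maximalSeparatedSet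

end Net

section Subgaussian

variable {Ω' : Type*} [MeasurableSpace Ω'] {μ : Measure Ω'}

lemma hasSubgaussianMGF_mono {Y : Ω' → ℝ} {c c' : ℝ≥0} (hY : HasSubgaussianMGF Y c μ)
    (hc : c ≤ c') : HasSubgaussianMGF Y c' μ where
  integrable_exp_mul := hY.integrable_exp_mul
  mgf_le t := (hY.mgf_le t).trans (by gcongr)

lemma measureReal_abs_ge_le [IsFiniteMeasure μ] {Y : Ω' → ℝ} {c : ℝ≥0}
    (hY : HasSubgaussianMGF Y c μ) {ε : ℝ} (hε : 0 ≤ ε) :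
    μ.real {ω | ε ≤ |Y ω|} ≤ 2 * Real.exp (-ε ^ 2 / (2 * c)) := by
  have hsub : {ω | ε ≤ |Y ω|} ⊆ {ω | ε ≤ Y ω} ∪ {ω | ε ≤ (-Y) ω} :=
    fun ω hω => by simpa [le_abs] using hω
  calc μ.real {ω | ε ≤ |Y ω|}
      ≤ μ.real {ω | ε ≤ Y ω} + μ.real {ω | ε ≤ (-Y) ω} :=
        (measureReal_mono hsub).trans (measureReal_union_le _ _)
    _ ≤ 2 * Real.exp (-ε ^ 2 / (2 * c)) := by
        rw [two_mul]
        exact add_le_add (hY.measure_ge_le hε) (hY.neg.measure_ge_le hε)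

/-- The majorant linearizes `exp` at `log B`, where `B` bounds the expectation of
`∑ᵢ (exp (τ Yᵢ) + exp (-τ Yᵢ))`. -/
lemma exists_integrable_majorant [IsProbabilityMeasure μ] {ι : Type*} {T : Finset ι}
    {Y : ι → Ω' → ℝ} {c : ℝ≥0} (hY : ∀ i ∈ T, HasSubgaussianMGF (Y i) c μ) {τ N : ℝ}
    (hτ : 0 < τ) (hN : 0 < N) (hT : T.card ≤ N) :
    ∃ Z : Ω' → ℝ, Integrable Z μ ∧ (∀ ω, ∀ i ∈ T, |Y i ω| ≤ Z ω) ∧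
      ∫ ω, Z ω ∂μ ≤ (Real.log (2 * N) + c * τ ^ 2 / 2) / τ := by
  set B : ℝ := 2 * N * Real.exp (c * τ ^ 2 / 2)
  have hB : 0 < B := by positivity
  let S : Ω' → ℝ := fun ω => ∑ i ∈ T, (Real.exp (τ * Y i ω) + Real.exp (-τ * Y i ω))
  have hexp : ∀ i ∈ T, Integrable (fun ω => Real.exp (τ * Y i ω) + Real.exp (-τ * Y i ω)) μ :=
    fun i hi => ((hY i hi).integrable_exp_mul τ).add ((hY i hi).integrable_exp_mul (-τ))
  have hS : Integrable S μ := integrable_finsetSum _ hexp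
  have hSB : ∫ ω, S ω ∂μ ≤ B := by
    calc ∫ ω, S ω ∂μ = ∑ i ∈ T, ∫ ω, (Real.exp (τ * Y i ω) + Real.exp (-τ * Y i ω)) ∂μ :=
          integral_finsetSum _ hexp
      _ ≤ ∑ _i ∈ T, 2 * Real.exp (c * τ ^ 2 / 2) := by
          refine Finset.sum_le_sum fun i hi => ?_
          rw [integral_add ((hY i hi).integrable_exp_mul τ) ((hY i hi).integrable_exp_mul (-τ)),
            two_mul]
          exact add_le_add ((hY i hi).mgf_le τ) (by simpa [mgf] using (hY i hi).mgf_le (-τ))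
      _ = T.card * (2 * Real.exp (c * τ ^ 2 / 2)) := by rw [Finset.sum_const, nsmul_eq_mul]
      _ ≤ N * (2 * Real.exp (c * τ ^ 2 / 2)) := by gcongr
      _ = B := by ring
  refine ⟨fun ω => (S ω / B + (Real.log B - 1)) / τ,
    ((hS.div_const B).add (integrable_const _)).div_const τ,
    fun ω i hi => ?_, ?_⟩
  · have hle : Real.exp (τ * |Y i ω|) ≤ S ω := by
      refine le_trans ?_ (Finset.single_le_sum (f := fun i => Real.exp (τ * Y i ω) +
        Real.exp (-τ * Y i ω)) (fun _ _ => by positivity) hi)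
      rw [← abs_of_pos hτ, ← abs_mul, abs_of_pos hτ, neg_mul]
      exact Real.exp_abs_le _
    have htangent := Real.add_one_le_exp (τ * |Y i ω| - Real.log B)
    rw [Real.exp_sub, Real.exp_log hB] at htangent
    rw [le_div_iff₀ hτ]
    linarith [div_le_div_of_nonneg_right hle hB.le]
  · have hlog : Real.log B = Real.log (2 * N) + c * τ ^ 2 / 2 := by
      rw [Real.log_mul (by positivity) (Real.exp_ne_zero _), Real.log_exp]
    rw [integral_div, integral_add (hS.div_const B) (integrable_const _), integral_div]
    simp only [integral_const, probReal_univ, one_smul, hlog]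
    exact div_le_div_of_nonneg_right (by linarith [(div_le_one hB).2 hSB]) hτ.le

lemma ae_tendsto_zero_of_tsum_ne_top {Y : ℕ → Ω' → ℝ}
    (hY : ∀ ε > 0, ∑' k, μ {ω | ε ≤ |Y k ω|} ≠ ∞) :
    ∀ᵐ ω ∂μ, Tendsto (fun k => Y k ω) atTop (𝓝 0) := by
  have hnear : ∀ᵐ ω ∂μ, ∀ m : ℕ, ∀ᶠ k in atTop, |Y k ω| < 1 / ((m : ℝ) + 1) := by
    refine ae_all_iff.2 fun m => ?_
    filter_upwards [ae_eventually_notMem (hY (1 / ((m : ℝ) + 1)) (by positivity))] with ω hω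
    exact hω.mono fun k hk => not_le.1 hk
  filter_upwards [hnear] with ω hω
  refine Metric.tendsto_nhds.2 fun ε hε => ?_
  obtain ⟨m, hm⟩ := exists_nat_one_div_lt hε
  filter_upwards [hω m] with k hk
  simpa using hk.trans hm

lemma summable_exp_neg_mul_rpow {κ γ : ℝ} (hκ : 0 < κ) (hγ : 0 < γ) :
    Summable fun k : ℕ => Real.exp (-κ * (k : ℝ) ^ γ) := by
  have hdecay : (fun k : ℕ => Real.exp (-κ * (k : ℝ) ^ γ)) =O[atTop]
      fun k : ℕ => ((k : ℝ) ^ γ) ^ (-(2 / γ)) :=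
    ((isLittleO_exp_neg_mul_rpow_atTop hκ _).comp_tendsto
      ((tendsto_rpow_atTop hγ).comp tendsto_natCast_atTop_atTop)).isBigO
  refine summable_of_isBigO_nat (Real.summable_nat_rpow_inv.2 one_lt_two)
    (hdecay.congr_right fun k => ?_)
  rw [← Real.rpow_mul (Nat.cast_nonneg k), ← Real.rpow_neg (Nat.cast_nonneg k)]
  congr 1
  field_simp

lemma ae_tendsto_zero_of_hasSubgaussianMGF [IsFiniteMeasure μ] {Y : ℕ → Ω' → ℝ} {c : ℕ → ℝ≥0}
    (hY : ∀ k, HasSubgaussianMGF (Y k) (c k) μ) {K γ : ℝ} (hK : 0 < K) (hγ : 0 < γ)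
    (hc : ∀ k : ℕ, 1 ≤ k → (c k : ℝ) ≤ K / (k : ℝ) ^ γ) :
    ∀ᵐ ω ∂μ, Tendsto (fun k => Y k ω) atTop (𝓝 0) := by
  have hshift : ∀ᵐ ω ∂μ, Tendsto (fun k => Y (k + 1) ω) atTop (𝓝 0) := by
    refine ae_tendsto_zero_of_tsum_ne_top fun ε hε => ?_
    set κ : ℝ := ε ^ 2 / (2 * K)
    have htail : ∀ k : ℕ, μ {ω | ε ≤ |Y (k + 1) ω|} ≤
        ENNReal.ofReal (2 * Real.exp (-κ * ((k + 1 : ℕ) : ℝ) ^ γ)) := by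
      intro k
      have : (0 : ℝ) < ((k + 1 : ℕ) : ℝ) ^ γ := by positivity
      have hsub : HasSubgaussianMGF (Y (k + 1)) (K / ((k + 1 : ℕ) : ℝ) ^ γ).toNNReal μ :=
        hasSubgaussianMGF_mono (hY (k + 1)) (NNReal.le_toNNReal_of_coe_le (hc (k + 1) (by omega)))
      rw [← ofReal_measureReal]
      refine ENNReal.ofReal_le_ofReal ((measureReal_abs_ge_le hsub hε.le).trans_eq ?_)
      rw [Real.coe_toNNReal _ (by positivity)]
      congr 2
      simp only [κ]
      field_simp
    refine ne_top_of_le_ne_top ?_ (ENNReal.tsum_le_tsum htail)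
    exact (((summable_nat_add_iff 1).2
      (summable_exp_neg_mul_rpow (by positivity) hγ)).mul_left 2).tsum_ofReal_ne_top
  exact hshift.mono fun ω hω => (tendsto_add_atTop_iff_nat 1).1 hω

end Subgaussian

/-- The error `(1 / A_k) ∑_{i ≤ k} α_i u(x, σ_i) - 𝔼 u(x, ·)` made by replacing the mean of
`u x` by its weighted average over the samples `σ 0, ..., σ k`. -/
def samplingError {X Ω V : Type*} [MeasurableSpace Ω] [NormedAddCommGroup V] [NormedSpace ℝ V]
    (P : Measure Ω) (a : ℕ → ℝ) (u : X → Ω → V) (σ : ℕ → Ω) (k : ℕ) (x : X) : V :=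
  weightedAvg a k (fun i => u x (σ i)) - ∫ t, u x t ∂P

/-- The `s k` are independent random variables on `(Ω', μ)` with common law `P`. -/
structure IsIIDSample {Ω Ω' : Type*} [MeasurableSpace Ω] [MeasurableSpace Ω'] (P : Measure Ω)
    (μ : Measure Ω') (s : ℕ → Ω' → Ω) : Prop where
  measurable : ∀ k, Measurable (s k)
  law : ∀ k, μ.map (s k) = P
  indep : iIndepFun s μ

/-- The rate `(1 + √(ln β_k)) / β_k` at which sampling errors decay, uniformly on bounded sets. -/
def rate (a : ℕ → ℝ) (k : ℕ) : ℝ := (1 + Real.sqrt (Real.log (beta a k))) / beta a k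

section Rate

variable {a : ℕ → ℝ}

lemma rate_pos (ha : ∀ k, 0 < a k) (k : ℕ) : 0 < rate a k :=
  div_pos (by positivity) (zero_lt_one.trans_le (one_le_beta ha k))

lemma inv_beta_le_rate (ha : ∀ k, 0 < a k) (k : ℕ) : (beta a k)⁻¹ ≤ rate a k := by
  have hβ := one_le_beta ha k
  rw [rate, inv_eq_one_div]
  gcongr
  exact le_add_of_nonneg_right (Real.sqrt_nonneg _)

lemma sqrt_one_add_log_div_beta_le_rate (ha : ∀ k, 0 < a k) (k : ℕ) :
    Real.sqrt (1 + Real.log (beta a k)) / beta a k ≤ rate a k := by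
  have hβ := one_le_beta ha k
  have hlog := Real.log_nonneg hβ
  rw [rate]
  gcongr
  refine Real.sqrt_le_iff.2 ⟨by positivity, ?_⟩
  nlinarith [Real.sq_sqrt hlog, Real.sqrt_nonneg (Real.log (beta a k))]

/-- Positive weights for which the expected sampling errors entering the descent of a run are
summable, and the variances of the sampling errors at a fixed point decay polynomially. -/
structure SamplingWeights (a : ℕ → ℝ) : Prop where
  pos : ∀ k, 0 < a k
  summable : Summable fun k : ℕ =>
    a (k + 1) * (1 + Real.sqrt (Real.log (beta a k))) / (beta a k * weightSum a (k + 1))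
  decay : ∃ N γ : ℝ, 0 < N ∧ 0 < γ ∧ ∀ k : ℕ, 1 ≤ k →
    (∑ i ∈ Finset.range (k + 1), a i ^ 2) / weightSum a k ^ 2 ≤ N / (k : ℝ) ^ γ

lemma AdmissibleWeights.samplingWeights (ha : AdmissibleWeights a) : SamplingWeights a where
  pos := ha.pos
  summable := ha.summable
  decay := ha.decay.imp fun _ ⟨γ, hN, hγ, hdecay, _⟩ => ⟨γ, hN, hγ, hdecay⟩

end Rate

section Sample

variable {Ω : Type*} [MeasurableSpace Ω] {P : Measure Ω} {Ω' : Type*} [MeasurableSpace Ω']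
  {μ : Measure Ω'} {s : ℕ → Ω' → Ω}

lemma IsIIDSample.isProbabilityMeasure [IsProbabilityMeasure μ] (hs : IsIIDSample P μ s) :
    IsProbabilityMeasure P :=
  hs.law 0 ▸ Measure.isProbabilityMeasure_map (hs.measurable 0).aemeasurable

lemma IsIIDSample.aemeasurable_comp {β : Type*} [MeasurableSpace β] (hs : IsIIDSample P μ s)
    {v : Ω → β} (hv : AEMeasurable v P) (k : ℕ) : AEMeasurable (fun ω => v (s k ω)) μ :=
  AEMeasurable.comp_aemeasurable (by rwa [hs.law]) (hs.measurable k).aemeasurable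

lemma IsIIDSample.integral_comp (hs : IsIIDSample P μ s) {v : Ω → ℝ}
    (hv : AEStronglyMeasurable v P) (k : ℕ) : ∫ ω, v (s k ω) ∂μ = ∫ t, v t ∂P := by
  rw [← hs.law k] at hv ⊢
  exact (integral_map (hs.measurable k).aemeasurable hv).symm

variable {X : Type*} {a : ℕ → ℝ} {u : X → Ω → ℝ} {x : X} {M : ℝ}

lemma samplingError_eq_sum (ha : ∀ k, 0 < a k) (σ : ℕ → Ω) (k : ℕ) :
    samplingError P a u σ k x = ∑ i ∈ Finset.range (k + 1),
      a i / weightSum a k * (u x (σ i) - ∫ t, u x t ∂P) := by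
  rw [samplingError, ← weightedAvg_const ha k (∫ t, u x t ∂P), ← weightedAvg_sub, weightedAvg,
    Finset.smul_sum]
  refine Finset.sum_congr rfl fun i _ => ?_
  simp only [smul_eq_mul, weightedAvg_const ha]
  ring

lemma abs_samplingError_le [IsProbabilityMeasure P] (ha : ∀ k, 0 < a k) (hM : ∀ t, |u x t| ≤ M)
    (σ : ℕ → Ω) (k : ℕ) : |samplingError P a u σ k x| ≤ 2 * M := by
  have havg : |weightedAvg a k fun i => u x (σ i)| ≤ M :=
    norm_weightedAvg_le (v := fun i => u x (σ i)) ha fun i _ => hM (σ i)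
  have hint : |∫ t, u x t ∂P| ≤ M := by
    simpa using norm_integral_le_of_norm_le_const (μ := P) (f := u x) (ae_of_all _ hM)
  rw [samplingError, two_mul]
  exact (abs_sub _ _).trans (add_le_add havg hint)

variable [IsProbabilityMeasure μ]

lemma IsIIDSample.hasSubgaussianMGF_sub_integral (hs : IsIIDSample P μ s) {v : Ω → ℝ}
    (hv : AEMeasurable v P) (hM : ∀ t, |v t| ≤ M) (k : ℕ) :
    HasSubgaussianMGF (fun ω => v (s k ω) - ∫ t, v t ∂P) (M ^ 2).toNNReal μ := by
  have hM₀ : 0 ≤ M := by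
    obtain ⟨ω⟩ := nonempty_of_isProbabilityMeasure μ
    exact (abs_nonneg _).trans (hM (s 0 ω))
  have hhoeffding := hasSubgaussianMGF_of_mem_Icc (a := -M) (b := M) (hs.aemeasurable_comp hv k)
    (ae_of_all _ fun ω => abs_le.1 (hM (s k ω)))
  rw [hs.integral_comp hv.aestronglyMeasurable] at hhoeffding
  convert hhoeffding using 1
  ext
  rw [Real.coe_toNNReal _ (by positivity)]
  push_cast
  rw [Real.norm_of_nonneg (by linarith)]
  ring

lemma IsIIDSample.hasSubgaussianMGF_samplingError (hs : IsIIDSample P μ s) (ha : ∀ k, 0 < a k)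
    (hm : AEMeasurable (u x) P) (hM : ∀ t, |u x t| ≤ M) (k : ℕ) :
    HasSubgaussianMGF (fun ω => samplingError P a u (fun i => s i ω) k x)
      (M ^ 2 / beta a k ^ 2).toNNReal μ := by
  have hA := weightSum_pos ha k
  have hindep : iIndepFun (fun i ω => a i / weightSum a k * (u x (s i ω) - ∫ t, u x t ∂P)) μ :=
    hs.indep.comp₀ (fun i t => a i / weightSum a k * (u x t - ∫ t, u x t ∂P))
      (fun i => (hs.measurable i).aemeasurable)
      (fun i => by rw [hs.law]; exact (hm.sub_const _).const_mul _)
  have hterm : ∀ i, HasSubgaussianMGF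
      (fun ω => a i / weightSum a k * (u x (s i ω) - ∫ t, u x t ∂P))
      (Real.toNNReal ((a i / weightSum a k) ^ 2) * (M ^ 2).toNNReal) μ := fun i => by
    rw [Real.toNNReal_of_nonneg (sq_nonneg _)]
    exact (hs.hasSubgaussianMGF_sub_integral hm hM i).const_mul _
  simp_rw [samplingError_eq_sum ha]
  convert HasSubgaussianMGF.sum_of_iIndepFun hindep (s := Finset.range (k + 1))
    fun i _ => hterm i using 1
  ext
  push_cast
  simp_rw [Real.coe_toNNReal _ (sq_nonneg _), div_pow]
  rw [Real.coe_toNNReal _ (by positivity), beta_sq, ← Finset.sum_mul, ← Finset.sum_div]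
  have := sum_sq_pos ha k
  field_simp

lemma IsIIDSample.ae_tendsto_samplingError (hs : IsIIDSample P μ s) (ha : SamplingWeights a)
    (hm : AEMeasurable (u x) P) (hM : ∀ t, |u x t| ≤ M) :
    ∀ᵐ ω ∂μ, Tendsto (fun k => samplingError P a u (fun i => s i ω) k x) atTop (𝓝 0) := by
  obtain ⟨N, γ, hN, hγ, hdecay⟩ := ha.decay
  refine ae_tendsto_zero_of_hasSubgaussianMGF (hs.hasSubgaussianMGF_samplingError ha.pos hm hM)
    (show 0 < (M ^ 2 + 1) * N by positivity) hγ fun k hk => ?_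
  have hβ : 1 / beta a k ^ 2 ≤ N / (k : ℝ) ^ γ := by
    rw [beta_sq, one_div_div]
    exact hdecay k hk
  rw [Real.coe_toNNReal _ (by positivity), mul_div_assoc, ← mul_one_div (M ^ 2)]
  gcongr
  exact le_add_of_nonneg_right zero_le_one

end Sample

section Uniform

lemma tendstoUniformlyOn_zero_of_lipschitzOnWith {X ι : Type*} [PseudoMetricSpace X]
    {l : Filter ι} {F : ι → X → ℝ} {Λ : ℝ≥0} {C D : Set X} (hC : TotallyBounded C)
    (hF : ∀ i, LipschitzOnWith Λ (F i) C) (hDC : D ⊆ C) (hCD : C ⊆ closure D)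
    (hD : ∀ x ∈ D, Tendsto (fun i => F i x) l (𝓝 0)) : TendstoUniformlyOn F 0 l C := by
  rw [Metric.tendstoUniformlyOn_iff]
  intro ε hε
  set δ : ℝ := ε / (2 * (Λ + 1))
  have hδ : 0 < δ := by positivity
  obtain ⟨T, hTD, hT, hcover⟩ : ∃ T ⊆ D, T.Finite ∧ ∀ x ∈ C, ∃ y ∈ T, dist x y < δ := by
    obtain ⟨T, hTD, hT, hDT⟩ :=
      Metric.finite_approx_of_totallyBounded (hC.subset hDC) (δ / 2) (half_pos hδ)
    refine ⟨T, hTD, hT, fun x hx => ?_⟩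
    obtain ⟨z, hz, hxz⟩ := Metric.mem_closure_iff.1 (hCD hx) (δ / 2) (half_pos hδ)
    obtain ⟨y, hy, hzy⟩ := Set.mem_iUnion₂.1 (hDT hz)
    exact ⟨y, hy, by linarith [dist_triangle x z y, Metric.mem_ball.1 hzy]⟩
  have hnet : ∀ᶠ i in l, ∀ y ∈ T, dist (F i y) 0 < ε / 2 :=
    (Filter.eventually_all_finite hT).2 fun y hy =>
      Metric.tendsto_nhds.1 (hD y (hTD hy)) _ (half_pos hε)
  filter_upwards [hnet] with i hi x hx
  obtain ⟨y, hy, hxy⟩ := hcover x hx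
  have hlip : dist (F i x) (F i y) ≤ ε / 2 := by
    calc dist (F i x) (F i y) ≤ Λ * dist x y := (hF i).dist_le_mul x hx y (hDC (hTD hy))
      _ ≤ (Λ + 1) * δ := by gcongr; exact le_add_of_nonneg_right zero_le_one
      _ = ε / 2 := by simp only [δ]; field_simp
  rw [Pi.zero_apply, dist_comm]
  linarith [dist_triangle (F i x) (F i y) 0, hi y hy]

variable {Ω : Type*} [MeasurableSpace Ω] {P : Measure Ω} {Ω' : Type*} [MeasurableSpace Ω']
  {μ : Measure Ω'} {s : ℕ → Ω' → Ω} {a : ℕ → ℝ} {M : ℝ} {Λ : ℝ≥0}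

lemma lipschitzOnWith_samplingError {X : Type*} [PseudoMetricSpace X] [IsProbabilityMeasure P]
    {u : X → Ω → ℝ} {C : Set X} (ha : ∀ k, 0 < a k) (hm : ∀ x ∈ C, AEMeasurable (u x) P)
    (hM : ∀ x ∈ C, ∀ t, |u x t| ≤ M) (hΛ : ∀ t, LipschitzOnWith Λ (fun x => u x t) C)
    (σ : ℕ → Ω) (k : ℕ) : LipschitzOnWith (Λ + Λ) (samplingError P a u σ k) C := by
  have hint : ∀ x ∈ C, Integrable (u x) P := fun x hx =>
    Integrable.of_bound (hm x hx).aestronglyMeasurable M (ae_of_all _ (hM x hx))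
  refine LipschitzOnWith.sub (.of_dist_le_mul fun x hx y hy => ?_)
    (.of_dist_le_mul fun x hx y hy => ?_)
  · rw [dist_eq_norm, ← weightedAvg_sub]
    exact norm_weightedAvg_le ha fun i _ => by
      simpa [dist_eq_norm] using (hΛ (σ i)).dist_le_mul x hx y hy
  · rw [dist_eq_norm, ← integral_sub (hint x hx) (hint y hy)]
    have hbound : ∀ᵐ t ∂P, ‖u x t - u y t‖ ≤ Λ * dist x y := ae_of_all _ fun t => by
      simpa only [dist_eq_norm] using (hΛ t).dist_le_mul x hx y hy
    simpa using norm_integral_le_of_norm_le_const hbound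

lemma IsIIDSample.ae_tendstoUniformlyOn_samplingError [IsProbabilityMeasure μ] {X : Type*}
    [PseudoMetricSpace X] {u : X → Ω → ℝ} {C : Set X} (hs : IsIIDSample P μ s)
    (ha : SamplingWeights a) (hC : TotallyBounded C) (hm : ∀ x ∈ C, AEMeasurable (u x) P)
    (hM : ∀ x ∈ C, ∀ t, |u x t| ≤ M) (hΛ : ∀ t, LipschitzOnWith Λ (fun x => u x t) C) :
    ∀ᵐ ω ∂μ, TendstoUniformlyOn (samplingError P a u fun i => s i ω) 0 atTop C := by
  have := hs.isProbabilityMeasure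
  obtain ⟨D, hDC, hD, hCD⟩ := hC.isSeparable.exists_countable_dense_subset
  filter_upwards [(ae_ball_iff hD).2 fun x hx =>
    hs.ae_tendsto_samplingError ha (hm x (hDC hx)) (hM x (hDC hx))] with ω hω
  exact tendstoUniformlyOn_zero_of_lipschitzOnWith hC
    (lipschitzOnWith_samplingError ha.pos hm hM hΛ _) hDC hCD hω

lemma abs_le_add_of_isCover {X : Type*} [PseudoMetricSpace X] {f : X → ℝ} {C T : Set X} {δ : ℝ≥0}
    {B : ℝ} (hf : LipschitzOnWith Λ f C) (hTC : T ⊆ C) (hT : Metric.IsCover δ C T)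
    (hB : ∀ y ∈ T, |f y| ≤ B) {x : X} (hx : x ∈ C) : |f x| ≤ B + Λ * δ := by
  obtain ⟨y, hy, hxy⟩ := hT hx
  have hxy : dist x y ≤ δ := by exact_mod_cast hxy
  have hlip : |f x - f y| ≤ Λ * δ :=
    (hf.dist_le_mul x hx y (hTC hy)).trans (by gcongr)
  linarith [hB y hy, abs_sub_abs_le_abs_sub (f x) (f y)]

lemma log_two_mul_mul_pow_le {K b : ℝ} (hK : 1 ≤ K) (hb : 1 ≤ b) (d : ℕ) :
    Real.log (2 * (K * b) ^ d) ≤ (1 + d * Real.log K + d) * (1 + Real.log b) := by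
  have hlogK := Real.log_nonneg hK
  have hlogb := Real.log_nonneg hb
  have hlog : Real.log (2 * (K * b) ^ d) = Real.log 2 + d * (Real.log K + Real.log b) := by
    rw [Real.log_mul two_ne_zero (by positivity), Real.log_pow,
      Real.log_mul (by positivity) (by positivity)]
  have hcross : 0 ≤ d * Real.log K * Real.log b := by positivity
  nlinarith [Real.log_two_lt_d9]

lemma log_add_div_le {K b : ℝ} (hK : 1 ≤ K) (hb : 1 ≤ b) (d : ℕ) (M : ℝ) :
    (Real.log (2 * (K * b) ^ d) + M ^ 2 / b ^ 2 * (b * Real.sqrt (1 + Real.log b)) ^ 2 / 2) /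
        (b * Real.sqrt (1 + Real.log b)) ≤
      (1 + d * Real.log K + d + M ^ 2 / 2) * (Real.sqrt (1 + Real.log b) / b) := by
  have hL : 0 < 1 + Real.log b := by linarith [Real.log_nonneg hb]
  have hvar : M ^ 2 / b ^ 2 * (b * Real.sqrt (1 + Real.log b)) ^ 2 / 2 =
      M ^ 2 / 2 * (1 + Real.log b) := by
    rw [mul_pow, Real.sq_sqrt hL.le]
    field_simp
  rw [hvar, div_le_iff₀ (by positivity)]
  calc Real.log (2 * (K * b) ^ d) + M ^ 2 / 2 * (1 + Real.log b)
      ≤ (1 + d * Real.log K + d + M ^ 2 / 2) * (1 + Real.log b) := by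
        linarith [log_two_mul_mul_pow_le hK hb d]
    _ = _ := by
        nth_rewrite 1 [← Real.sq_sqrt hL.le]
        field_simp

variable {F : Type*} [NormedAddCommGroup F] [NormedSpace ℝ F] [FiniteDimensional ℝ F]

/-- A `1 / β_k`-net of a bounded set has polynomially many points in `β_k`, so the maximal
inequality costs a factor `√(1 + ln β_k)` over the deviation `1 / β_k` of a single average. -/
lemma IsIIDSample.exists_integral_samplingError_le [IsProbabilityMeasure μ] {u : F → Ω → ℝ}
    {C : Set F} (hs : IsIIDSample P μ s) (ha : ∀ k, 0 < a k) (hC : Bornology.IsBounded C)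
    (hm : ∀ x ∈ C, AEMeasurable (u x) P) (hM : ∀ x ∈ C, ∀ t, |u x t| ≤ M)
    (hΛ : ∀ t, LipschitzOnWith Λ (fun x => u x t) C) :
    ∃ c : ℝ, ∀ k, ∃ Z : Ω' → ℝ, Integrable Z μ ∧
      (∀ ω, ∀ x ∈ C, |samplingError P a u (fun i => s i ω) k x| ≤ Z ω) ∧
      ∫ ω, Z ω ∂μ ≤ c * rate a k := by
  have := hs.isProbabilityMeasure
  obtain ⟨R, hR, hCR⟩ := hC.subset_closedBall_lt 0 (0 : F)
  have hlogR : 0 ≤ Real.log (2 * R + 1) := Real.log_nonneg (by linarith)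
  set d := Module.finrank ℝ F
  set c : ℝ := 1 + d * Real.log (2 * R + 1) + d + M ^ 2 / 2
  refine ⟨c + 2 * Λ, fun k => ?_⟩
  set b := beta a k
  have hb : 1 ≤ b := one_le_beta ha k
  have hL := Real.log_nonneg hb
  obtain ⟨T, hTC, hnet, hcard⟩ := exists_net hR.le (δ := (b⁻¹).toNNReal) (by positivity) hCR
  rw [Real.coe_toNNReal _ (by positivity)] at hcard
  have hcard : (T.card : ℝ) ≤ ((2 * R + 1) * b) ^ d := hcard.trans <| by
    gcongr
    rw [div_inv_eq_mul]
    linarith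
  set τ : ℝ := b * Real.sqrt (1 + Real.log b)
  obtain ⟨Z, hZint, hZ, hZle⟩ := exists_integrable_majorant
    (fun x hx => hs.hasSubgaussianMGF_samplingError ha (hm x (hTC hx)) (hM x (hTC hx)) k)
    (show 0 < τ by positivity) (by positivity) hcard
  refine ⟨fun ω => Z ω + 2 * Λ * b⁻¹, hZint.add (integrable_const _), fun ω x hx => ?_, ?_⟩
  · have hlip := lipschitzOnWith_samplingError ha hm hM hΛ (fun i => s i ω) k
    simpa [two_mul, hb.trans' zero_le_one] using abs_le_add_of_isCover hlip hTC hnet (hZ ω) hx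
  rw [integral_add hZint (integrable_const _), integral_const, probReal_univ, one_smul, add_mul]
  rw [Real.coe_toNNReal _ (by positivity)] at hZle
  gcongr
  · refine (hZle.trans (log_add_div_le (by linarith) hb d M)).trans ?_
    gcongr
    exact sqrt_one_add_log_div_beta_le_rate ha k
  · exact inv_beta_le_rate ha k

end Uniform

section RobbinsSiegmund

lemma tendsto_and_summable_of_le {v δ e : ℕ → ℝ} (hδ : ∀ k, 0 ≤ δ k)
    (hstep : ∀ k, v (k + 1) ≤ v k - δ k + e k) {b : ℝ} (hb : ∀ k, b ≤ v k) {c : ℝ}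
    (he : Tendsto (fun K => ∑ k ∈ Finset.range K, e k) atTop (𝓝 c)) :
    (∃ l : ℝ, Tendsto v atTop (𝓝 l)) ∧ Summable δ := by
  obtain ⟨B, hB⟩ := he.bddAbove_range
  let q : ℕ → ℝ := fun K => v K - ∑ k ∈ Finset.range K, e k
  have hdecrease : ∀ k, δ k ≤ q k - q (k + 1) := fun k => by
    simp only [q, Finset.sum_range_succ]
    linarith [hstep k]
  have hbelow : ∀ k, b - B ≤ q k := fun k => sub_le_sub (hb k) (hB ⟨k, rfl⟩)
  have hanti : Antitone q := antitone_nat_of_succ_le fun k => by linarith [hdecrease k, hδ k]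
  refine ⟨⟨_, ((tendsto_atTop_ciInf hanti ⟨b - B, ?_⟩).add he).congr fun k => ?_⟩, ?_⟩
  · rintro _ ⟨k, rfl⟩
    exact hbelow k
  · exact sub_add_cancel _ _
  · refine summable_of_sum_range_le (c := q 0 - (b - B)) hδ fun K => ?_
    calc ∑ k ∈ Finset.range K, δ k ≤ ∑ k ∈ Finset.range K, (q k - q (k + 1)) :=
          Finset.sum_le_sum fun k _ => hdecrease k
      _ = q 0 - q K := Finset.sum_range_sub' q K
      _ ≤ q 0 - (b - B) := sub_le_sub_left (hbelow K) _

end RobbinsSiegmund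

section RelativeWeight

/-- The relative weight `α_k / A_k` of the sample `k` in the average formed at step `k`. -/
def relWeight (a : ℕ → ℝ) (k : ℕ) : ℝ := a k / weightSum a k

variable {a : ℕ → ℝ}

lemma relWeight_pos (ha : ∀ k, 0 < a k) (k : ℕ) : 0 < relWeight a k :=
  div_pos (ha k) (weightSum_pos ha k)

lemma inv_beta_sq_succ (ha : ∀ k, 0 < a k) (k : ℕ) :
    (beta a (k + 1) ^ 2)⁻¹ =
      (1 - relWeight a (k + 1)) ^ 2 * (beta a k ^ 2)⁻¹ + relWeight a (k + 1) ^ 2 := by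
  have hk := weightSum_pos ha k
  have hk' := weightSum_pos ha (k + 1)
  have hratio : 1 - relWeight a (k + 1) = weightSum a k / weightSum a (k + 1) := by
    rw [relWeight, one_sub_div hk'.ne', weightSum_succ, add_sub_cancel_right]
  rw [hratio, beta_sq, beta_sq, inv_div, inv_div, Finset.sum_range_succ _ (k + 1), relWeight]
  field_simp

lemma inv_beta_sq_le_rate (ha : ∀ k, 0 < a k) (k : ℕ) : (beta a k ^ 2)⁻¹ ≤ rate a k := by
  have hβ := one_le_beta ha k
  refine (inv_anti₀ (by positivity) ?_).trans (inv_beta_le_rate ha k)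
  exact le_self_pow₀ hβ two_ne_zero

lemma SamplingWeights.summable_relWeight_mul_rate (ha : SamplingWeights a) :
    Summable fun k => relWeight a (k + 1) * rate a k := by
  refine ha.summable.congr fun k => ?_
  rw [relWeight, rate, div_mul_div_comm, mul_comm (weightSum a (k + 1))]

/-- The recursion for `1 / β_k²` makes the squares of the relative weights telescope, up to
terms controlled by the summability condition. -/
lemma SamplingWeights.summable_relWeight_sq (ha : SamplingWeights a) :
    Summable fun k => relWeight a k ^ 2 := by
  rw [← summable_nat_add_iff 1]
  let y : ℕ → ℝ := fun k => (beta a k ^ 2)⁻¹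
  have hstep : ∀ k, relWeight a (k + 1) ^ 2 ≤
      y (k + 1) - y k + 2 * (relWeight a (k + 1) * rate a k) := fun k => by
    have hw := relWeight_pos ha.pos (k + 1)
    have hy : 0 ≤ y k := by positivity
    have hrate : relWeight a (k + 1) * y k ≤ relWeight a (k + 1) * rate a k :=
      mul_le_mul_of_nonneg_left (inv_beta_sq_le_rate ha.pos k) hw.le
    have hrec : y (k + 1) = (1 - relWeight a (k + 1)) ^ 2 * y k + relWeight a (k + 1) ^ 2 :=
      inv_beta_sq_succ ha.pos k
    linarith [mul_nonneg (sq_nonneg (relWeight a (k + 1))) hy,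
      (by ring : (1 - relWeight a (k + 1)) ^ 2 * y k =
        y k - 2 * (relWeight a (k + 1) * y k) + relWeight a (k + 1) ^ 2 * y k)]
  refine summable_of_sum_range_le (c := 1 + 2 * ∑' k, relWeight a (k + 1) * rate a k)
    (fun k => sq_nonneg _) fun K => ?_
  calc ∑ k ∈ Finset.range K, relWeight a (k + 1) ^ 2
      ≤ ∑ k ∈ Finset.range K, (y (k + 1) - y k + 2 * (relWeight a (k + 1) * rate a k)) :=
        Finset.sum_le_sum fun k _ => hstep k
    _ = y K - y 0 + 2 * ∑ k ∈ Finset.range K, relWeight a (k + 1) * rate a k := by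
        rw [Finset.sum_add_distrib, Finset.sum_range_sub, Finset.mul_sum]
    _ ≤ 1 + 2 * ∑' k, relWeight a (k + 1) * rate a k := by
        have hyK : y K ≤ 1 := inv_le_one_of_one_le₀ (one_le_pow₀ (one_le_beta ha.pos K))
        have hy₀ : 0 ≤ y 0 := by positivity
        have hsum := ha.summable_relWeight_mul_rate.sum_le_tsum (Finset.range K) fun k _ =>
          (mul_pos (relWeight_pos ha.pos (k + 1)) (rate_pos ha.pos k)).le
        linarith

end RelativeWeight

section Martingale

variable {Ω' : Type*} {mΩ' : MeasurableSpace Ω'} {μ : Measure Ω'}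

lemma ae_summable_of_summable_integral {f : ℕ → Ω' → ℝ} (hf : ∀ k, Integrable (f k) μ)
    (hf₀ : ∀ k ω, 0 ≤ f k ω) (hsum : Summable fun k => ∫ ω, f k ω ∂μ) :
    ∀ᵐ ω ∂μ, Summable fun k => f k ω := by
  have hmeas : ∀ k, AEMeasurable (fun ω => ENNReal.ofReal (f k ω)) μ := fun k =>
    (hf k).aemeasurable.ennreal_ofReal
  have hfin : ∫⁻ ω, ∑' k, ENNReal.ofReal (f k ω) ∂μ ≠ ∞ := by
    simp_rw [lintegral_tsum hmeas,
      ← ofReal_integral_eq_lintegral_ofReal (hf _) (ae_of_all _ (hf₀ _))]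
    exact hsum.tsum_ofReal_ne_top
  filter_upwards [ae_lt_top' (AEMeasurable.tsum hmeas) hfin] with ω hω
  exact (ENNReal.summable_toReal hω.ne).congr fun k => ENNReal.toReal_ofReal (hf₀ k ω)

lemma integral_norm_le_one_add_integral_sq [IsProbabilityMeasure μ] {f : Ω' → ℝ}
    (hf : MemLp f 2 μ) : ∫ ω, ‖f ω‖ ∂μ ≤ 1 + ∫ ω, f ω ^ 2 ∂μ := by
  calc ∫ ω, ‖f ω‖ ∂μ ≤ ∫ ω, (1 + f ω ^ 2) ∂μ := by
        refine integral_mono (hf.integrable one_le_two).norm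
          ((integrable_const 1).add hf.integrable_sq) fun ω => ?_
        rw [Real.norm_eq_abs, ← sq_abs (f ω)]
        nlinarith [sq_nonneg (|f ω| - 1), abs_nonneg (f ω)]
    _ = 1 + ∫ ω, f ω ^ 2 ∂μ := by
        rw [integral_add (integrable_const 1) hf.integrable_sq, integral_const, probReal_univ,
          one_smul]

variable {ℱ : Filtration ℕ mΩ'} {S : ℕ → Ω' → ℝ} {b : ℕ → ℝ}

lemma memLp_two_of_abs_sub_le [IsFiniteMeasure μ] (hS : ∀ k, Integrable (S k) μ)
    (hS₀ : S 0 = 0) (hb : ∀ k ω, |S (k + 1) ω - S k ω| ≤ b k) (K : ℕ) : MemLp (S K) 2 μ := by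
  induction K with
  | zero => exact hS₀ ▸ MemLp.zero
  | succ K ih =>
    have hstep : MemLp (S (K + 1) - S K) 2 μ :=
      .of_bound ((hS _).sub (hS _)).aestronglyMeasurable (b K) (ae_of_all _ (hb K))
    simpa using ih.add hstep

lemma integral_mul_sub_eq_zero_of_martingale [IsFiniteMeasure μ] (hS : Martingale S ℱ μ)
    (hL2 : ∀ k, MemLp (S k) 2 μ) (K : ℕ) : ∫ ω, S K ω * (S (K + 1) ω - S K ω) ∂μ = 0 := by
  have hD : MemLp (S (K + 1) - S K) 2 μ := (hL2 (K + 1)).sub (hL2 K)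
  have hcond : μ[S (K + 1) - S K | ℱ K] =ᵐ[μ] 0 := by
    refine (condExp_sub (hS.integrable _) (hS.integrable _) _).trans ?_
    filter_upwards [hS.condExp_ae_eq K.le_succ, hS.condExp_ae_eq (le_refl K)] with ω hsucc hself
    exact sub_eq_zero.2 (hsucc.trans hself.symm)
  refine (integral_condExp (ℱ.le K) (f := S K * (S (K + 1) - S K))).symm.trans
    (integral_eq_zero_of_ae ?_)
  filter_upwards [condExp_mul_of_stronglyMeasurable_left (hS.stronglyAdapted K)
    ((hL2 K).integrable_mul hD) (hD.integrable one_le_two), hcond] with ω hpull hω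
  rw [hpull, Pi.mul_apply, hω, Pi.zero_apply, mul_zero]

lemma integral_sq_le_sum_of_martingale [IsProbabilityMeasure μ] (hS : Martingale S ℱ μ)
    (hS₀ : S 0 = 0) (hb : ∀ k ω, |S (k + 1) ω - S k ω| ≤ b k) (K : ℕ) :
    ∫ ω, S K ω ^ 2 ∂μ ≤ ∑ k ∈ Finset.range K, b k ^ 2 := by
  have hL2 := memLp_two_of_abs_sub_le (μ := μ) hS.integrable hS₀ hb
  induction K with
  | zero => simp [hS₀]
  | succ K ih =>
    let D : Ω' → ℝ := fun ω => S (K + 1) ω - S K ω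
    have hD : MemLp D 2 μ := (hL2 (K + 1)).sub (hL2 K)
    have hSD : Integrable (fun ω => S K ω * D ω) μ := (hL2 K).integrable_mul hD
    have hDsq : ∫ ω, D ω ^ 2 ∂μ ≤ b K ^ 2 := by
      have hle := integral_mono hD.integrable_sq (integrable_const (b K ^ 2)) fun ω =>
        sq_le_sq.2 ((hb K ω).trans (le_abs_self _))
      simpa using hle
    have hexpand : ∀ ω, S (K + 1) ω ^ 2 = S K ω ^ 2 + 2 * (S K ω * D ω) + D ω ^ 2 := fun ω => by
      simp only [D]
      ring
    simp_rw [hexpand]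
    rw [integral_add (by exact (hL2 K).integrable_sq.add (hSD.const_mul 2)) hD.integrable_sq,
      integral_add (hL2 K).integrable_sq (hSD.const_mul 2), integral_const_mul,
      integral_mul_sub_eq_zero_of_martingale hS hL2, mul_zero, add_zero, Finset.sum_range_succ]
    exact add_le_add ih hDsq

lemma ae_tendsto_of_martingale_of_summable_sq [IsProbabilityMeasure μ] (hS : Martingale S ℱ μ)
    (hS₀ : S 0 = 0) (hb : ∀ k ω, |S (k + 1) ω - S k ω| ≤ b k) (hsum : Summable fun k => b k ^ 2) :
    ∀ᵐ ω ∂μ, ∃ l, Tendsto (fun k => S k ω) atTop (𝓝 l) := by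
  refine hS.submartingale.exists_ae_tendsto_of_bdd
    (R := (1 + ∑' k, b k ^ 2).toNNReal) fun K => ?_
  rw [eLpNorm_one_eq_lintegral_enorm, ← ofReal_integral_norm_eq_lintegral_enorm (hS.integrable K)]
  refine ENNReal.ofReal_le_ofReal ?_
  refine (integral_norm_le_one_add_integral_sq
    (memLp_two_of_abs_sub_le hS.integrable hS₀ hb K)).trans ?_
  gcongr
  exact (integral_sq_le_sum_of_martingale hS hS₀ hb K).trans
    (hsum.sum_le_tsum _ fun k _ => sq_nonneg _)

end Martingale

section Independence

variable {Ω' X Ω : Type*} {m mΩ' : MeasurableSpace Ω'} {μ : Measure Ω'} [MeasurableSpace X]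
  [MeasurableSpace Ω] {ξ : Ω' → X} {η : Ω' → Ω}

lemma map_restrict_prodMk_eq_prod_of_indep [IsFiniteMeasure μ] (hm : m ≤ mΩ')
    (hξ : Measurable[m] ξ) (hη : Measurable η)
    (hind : Indep (MeasurableSpace.comap η inferInstance) m μ) {A : Set Ω'}
    (hA : MeasurableSet[m] A) :
    (μ.restrict A).map (fun ω => (ξ ω, η ω)) = ((μ.restrict A).map ξ).prod (μ.map η) := by
  have hξ' : Measurable ξ := hξ.mono hm le_rfl
  have hpair : Measurable fun ω => (ξ ω, η ω) := hξ'.prodMk hη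
  refine (Measure.prod_eq fun U V hU hV => ?_).symm
  rw [Measure.map_apply hpair (hU.prod hV), Measure.map_apply hξ' hU, Measure.map_apply hη hV,
    Measure.restrict_apply (hpair (hU.prod hV)), Measure.restrict_apply (hξ' hU), mul_comm,
    ← (Indep_iff _ _ _).1 hind _ _ ⟨V, hV, rfl⟩ ((hξ hU).inter hA)]
  congr 1
  ext ω
  simp only [Set.mem_inter_iff, Set.mem_preimage, Set.mem_prod]
  tauto

lemma condExp_comp_eq_zero_of_indep [IsFiniteMeasure μ] (hm : m ≤ mΩ') (hξ : Measurable[m] ξ)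
    (hη : Measurable η) (hind : Indep (MeasurableSpace.comap η inferInstance) m μ)
    {φ : X → Ω → ℝ} (hφ : Measurable (Function.uncurry φ)) {B : ℝ} (hB : ∀ y t, |φ y t| ≤ B)
    (hφ₀ : ∀ y, ∫ t, φ y t ∂(μ.map η) = 0) :
    μ[fun ω => φ (ξ ω) (η ω) | m] =ᵐ[μ] 0 := by
  have hpair : Measurable fun ω => (ξ ω, η ω) := (hξ.mono hm le_rfl).prodMk hη
  have hint : ∀ ν : Measure (X × Ω), IsFiniteMeasure ν → Integrable (Function.uncurry φ) ν :=
    fun ν _ => .of_bound hφ.aestronglyMeasurable B (ae_of_all _ fun q => hB q.1 q.2)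
  refine (ae_eq_condExp_of_forall_setIntegral_eq hm ((hint _ inferInstance).comp_measurable hpair)
    (fun A _ _ => integrableOn_zero) (fun A hA _ => ?_)
    stronglyMeasurable_zero.aestronglyMeasurable).symm
  calc ∫ ω in A, (0 : Ω' → ℝ) ω ∂μ = 0 := by simp
    _ = ∫ q, Function.uncurry φ q ∂(((μ.restrict A).map ξ).prod (μ.map η)) := by
        rw [integral_prod _ (hint _ inferInstance)]
        simp [hφ₀]
    _ = ∫ ω in A, φ (ξ ω) (η ω) ∂μ := by
        rw [← map_restrict_prodMk_eq_prod_of_indep hm hξ hη hind hA,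
          integral_map hpair.aemeasurable hφ.aestronglyMeasurable]
        rfl

end Independence

section JointMeasurability

variable {X Ω : Type*} [TopologicalSpace X] [TopologicalSpace.MetrizableSpace X]
  [SecondCountableTopology X] [MeasurableSpace X] [OpensMeasurableSpace X] [MeasurableSpace Ω]
  {P : Measure Ω} {u : X → Ω → ℝ}

lemma exists_measurable_uncurry_indicator (hc : ∀ t, Continuous fun y => u y t)
    (hm : ∀ y, AEMeasurable (u y) P) :
    ∃ A : Set Ω, (∀ᵐ t ∂P, t ∈ A) ∧
      Measurable (Function.uncurry fun y => A.indicator (u y)) := by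
  obtain ⟨D, hD, hdense⟩ := TopologicalSpace.exists_countable_dense X
  have hmk : ∀ᵐ t ∂P, ∀ y ∈ D, u y t = (hm y).mk _ t :=
    (ae_ball_iff hD).2 fun y _ => (hm y).ae_eq_mk
  obtain ⟨N, hN, hNm, hN₀⟩ := exists_measurable_superset_of_null (ae_iff.1 hmk)
  refine ⟨Nᶜ, measure_eq_zero_iff_ae_notMem.1 hN₀, ?_⟩
  have hcont : ∀ t, Continuous fun y => Nᶜ.indicator (u y) t := fun t => by
    by_cases ht : t ∈ N
    · simpa [ht] using continuous_const
    · simpa [ht] using hc t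
  have hDm : ∀ y ∈ D, Measurable (Nᶜ.indicator (u y)) := fun y hy => by
    have heq : Nᶜ.indicator (u y) = Nᶜ.indicator ((hm y).mk _) :=
      Set.indicator_congr fun t ht => not_not.1 fun hne => ht (hN fun h => hne (h y hy))
    rw [heq]
    exact (hm y).measurable_mk.indicator hNm.compl
  refine measurable_uncurry_of_continuous_of_measurable hcont fun y => ?_
  obtain ⟨q, hq, hqy⟩ := mem_closure_iff_seq_limit.1 (hdense y)
  exact measurable_of_tendsto_metrizable (fun k => hDm (q k) (hq k))
    (tendsto_pi_nhds.2 fun t => ((hcont t).tendsto y).comp hqy)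

lemma exists_measurable_centered [IsProbabilityMeasure P] (hc : ∀ t, Continuous fun y => u y t)
    (hm : ∀ y, AEMeasurable (u y) P) {C : Set X} (hC : MeasurableSet C) {M : ℝ} (hM₀ : 0 ≤ M)
    (hM : ∀ y ∈ C, ∀ t, |u y t| ≤ M) :
    ∃ φ : X → Ω → ℝ, Measurable (Function.uncurry φ) ∧ (∀ y t, |φ y t| ≤ 2 * M) ∧
      (∀ y, ∫ t, φ y t ∂P = 0) ∧ ∀ᵐ t ∂P, ∀ y ∈ C, φ y t = ∫ t, u y t ∂P - u y t := by
  obtain ⟨A, hA, hmeas⟩ := exists_measurable_uncurry_indicator hc hm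
  let v : X → Ω → ℝ := fun y t => C.indicator (fun y => A.indicator (u y) t) y
  have hv : Measurable (Function.uncurry v) := hmeas.indicator (measurable_fst hC)
  have hvM : ∀ y t, |v y t| ≤ M := fun y t => by
    by_cases hy : y ∈ C <;> by_cases ht : t ∈ A <;> simp [v, hy, ht, hM₀, hM]
  have hvint : ∀ y, Integrable (v y) P := fun y =>
    .of_bound (hv.comp measurable_prodMk_left).aestronglyMeasurable M (ae_of_all _ (hvM y))
  have hvmean : ∀ y, |∫ t, v y t ∂P| ≤ M := fun y => by
    simpa using norm_integral_le_of_norm_le_const (μ := P) (f := v y) (ae_of_all _ (hvM y))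
  refine ⟨fun y t => ∫ t, v y t ∂P - v y t, ?_, fun y t => ?_, fun y => ?_, ?_⟩
  · exact (hv.stronglyMeasurable.integral_prod_right.measurable.comp measurable_fst).sub hv
  · exact (abs_sub _ _).trans (by linarith [hvmean y, hvM y t])
  · rw [integral_sub (integrable_const _) (hvint y)]
    simp
  · filter_upwards [hA] with t ht y hy
    have heq : v y =ᵐ[P] u y := by
      filter_upwards [hA] with t ht
      simp [v, hy, ht]
    rw [integral_congr_ae heq]
    simp [v, hy, ht]

end JointMeasurability

section StepError

variable {n : ℕ} {Ω : Type*} [MeasurableSpace Ω] {P : Measure Ω} {Ω' : Type*}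
  {s : ℕ → Ω' → Ω} {x : ℕ → Ω' → E n}

lemma history_mono : Monotone (history s x) := fun _ _ hkl =>
  sup_le_sup (biSup_mono fun _ hi => hi.trans_le hkl) (biSup_mono fun _ hi => hi.trans hkl)

lemma measurable_iterate_history {i k : ℕ} (h : i ≤ k) : Measurable[history s x k] (x i) :=
  measurable_iff_comap_le.2 <| (le_iSup₂_of_le
    (f := fun i (_ : i ≤ k) => MeasurableSpace.comap (x i) inferInstance) i h le_rfl).trans
      le_sup_right

lemma measurable_sample_history {i k : ℕ} (h : i < k) : Measurable[history s x k] (s i) :=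
  measurable_iff_comap_le.2 <| (le_iSup₂_of_le
    (f := fun i (_ : i < k) => MeasurableSpace.comap (s i) inferInstance) i h le_rfl).trans
      le_sup_left

variable [mΩ' : MeasurableSpace Ω']

/-- The filtration generated by the past samples and iterates, bundling `history`. -/
def historyFiltration (hs : ∀ k, Measurable (s k)) (hx : ∀ k, Measurable (x k)) :
    Filtration ℕ mΩ' where
  seq := history s x
  mono' := history_mono
  le' _ := sup_le (iSup₂_le fun i _ => (hs i).comap_le) (iSup₂_le fun i _ => (hx i).comap_le)

variable {μ : Measure Ω'} [IsProbabilityMeasure μ]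

section Centered

variable {φ : E n → Ω → ℝ} {B : ℝ}

lemma condExp_history_eq_zero (hs : IsIIDSample P μ s) (hx : ∀ k, Measurable (x k))
    (hfresh : ∀ k, Indep (MeasurableSpace.comap (s k) inferInstance) (history s x k) μ)
    (hφ : Measurable (Function.uncurry φ)) (hB : ∀ y t, |φ y t| ≤ B)
    (hφ₀ : ∀ y, ∫ t, φ y t ∂P = 0) (k : ℕ) :
    μ[fun ω => φ (x k ω) (s k ω) | history s x k] =ᵐ[μ] 0 :=
  condExp_comp_eq_zero_of_indep ((historyFiltration hs.measurable hx).le k)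
    (measurable_iterate_history le_rfl) (hs.measurable k) (hfresh k) hφ hB
    (by rwa [hs.law k])

lemma integral_comp_iterate_sample_eq_zero (hs : IsIIDSample P μ s) (hx : ∀ k, Measurable (x k))
    (hfresh : ∀ k, Indep (MeasurableSpace.comap (s k) inferInstance) (history s x k) μ)
    (hφ : Measurable (Function.uncurry φ)) (hB : ∀ y t, |φ y t| ≤ B)
    (hφ₀ : ∀ y, ∫ t, φ y t ∂P = 0) (k : ℕ) : ∫ ω, φ (x k ω) (s k ω) ∂μ = 0 :=
  (integral_condExp ((historyFiltration hs.measurable hx).le k)).symm.trans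
    (integral_eq_zero_of_ae (condExp_history_eq_zero hs hx hfresh hφ hB hφ₀ k))

lemma martingale_sum_comp_iterate_sample (hs : IsIIDSample P μ s) (hx : ∀ k, Measurable (x k))
    (hfresh : ∀ k, Indep (MeasurableSpace.comap (s k) inferInstance) (history s x k) μ)
    (hφ : Measurable (Function.uncurry φ)) (hB : ∀ y t, |φ y t| ≤ B)
    (hφ₀ : ∀ y, ∫ t, φ y t ∂P = 0) (c : ℕ → ℝ) :
    Martingale (fun K ω => ∑ k ∈ Finset.range K, c k * φ (x k ω) (s k ω))
      (historyFiltration hs.measurable hx) μ := by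
  have hterm : ∀ k l, k < l → Measurable[history s x l] fun ω => φ (x k ω) (s k ω) :=
    fun k l hkl => hφ.comp
      ((measurable_iterate_history hkl.le).prodMk (measurable_sample_history hkl))
  have hint : ∀ k, Integrable (fun ω => φ (x k ω) (s k ω)) μ := fun k =>
    .of_bound (hφ.comp ((hx k).prodMk (hs.measurable k))).aestronglyMeasurable B
      (ae_of_all _ fun ω => hB _ _)
  refine martingale_of_condExp_sub_eq_zero_nat (fun K => ?_)
    (fun K => integrable_finsetSum _ fun k _ => (hint k).const_mul _) fun K => ?_
  · exact (Finset.measurable_fun_sum _ fun k hk =>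
      (hterm k K (Finset.mem_range.1 hk)).const_mul _).stronglyMeasurable
  · have hdiff : ((fun ω => ∑ k ∈ Finset.range (K + 1), c k * φ (x k ω) (s k ω)) -
        fun ω => ∑ k ∈ Finset.range K, c k * φ (x k ω) (s k ω)) =
        c K • fun ω => φ (x K ω) (s K ω) := by
      funext ω
      simp [Finset.sum_range_succ]
    rw [hdiff]
    refine (condExp_smul _ _ _).trans ?_
    filter_upwards [condExp_history_eq_zero hs hx hfresh hφ hB hφ₀ K] with ω hω
    exact (congrArg (c K * ·) hω).trans (mul_zero _)

lemma ae_tendsto_sum_comp_iterate_sample (hs : IsIIDSample P μ s) (hx : ∀ k, Measurable (x k))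
    (hfresh : ∀ k, Indep (MeasurableSpace.comap (s k) inferInstance) (history s x k) μ)
    (hφ : Measurable (Function.uncurry φ)) (hB : ∀ y t, |φ y t| ≤ B)
    (hφ₀ : ∀ y, ∫ t, φ y t ∂P = 0) {c : ℕ → ℝ} (hc : Summable fun k => c k ^ 2) :
    ∀ᵐ ω ∂μ, ∃ l, Tendsto (fun K => ∑ k ∈ Finset.range K, c k * φ (x k ω) (s k ω))
      atTop (𝓝 l) := by
  refine ae_tendsto_of_martingale_of_summable_sq (b := fun k => |c k| * B)
    (martingale_sum_comp_iterate_sample hs hx hfresh hφ hB hφ₀ c) (by simp; rfl) (fun k ω => ?_) ?_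
  · rw [Finset.sum_range_succ, add_sub_cancel_left, abs_mul]
    exact mul_le_mul_of_nonneg_left (hB _ _) (abs_nonneg _)
  · simpa only [mul_pow, sq_abs] using hc.mul_right (B ^ 2)

end Centered

section Noise

variable {a : ℕ → ℝ} {u : E n → Ω → ℝ} {C : Set (E n)} {M : ℝ} {Λ : ℝ≥0}

lemma exists_relWeight_mul_samplingError_le (hs : IsIIDSample P μ s) (ha : SamplingWeights a)
    (hm : ∀ y, AEMeasurable (u y) P) (hC : Bornology.IsBounded C) (hne : C.Nonempty)
    (hM : ∀ y ∈ C, ∀ t, |u y t| ≤ M) (hΛ : ∀ t, LipschitzOnWith Λ (fun y => u y t) C) :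
    ∃ e : ℕ → Ω' → ℝ, ∃ B : ℝ, (∀ k, Integrable (e k) μ) ∧ (∀ᵐ ω ∂μ, Summable fun k => e k ω) ∧
      (∀ K, ∑ k ∈ Finset.range K, ∫ ω, e k ω ∂μ ≤ B) ∧
      ∀ ω k, ∀ y ∈ C, relWeight a (k + 1) * samplingError P a u (fun i => s i ω) k y ≤ e k ω := by
  obtain ⟨c, hmajorant⟩ := hs.exists_integral_samplingError_le ha.pos hC (fun y _ => hm y) hM hΛ
  choose Z hZint hZ hZle using hmajorant
  obtain ⟨y₀, hy₀⟩ := hne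
  have hw := fun k => (relWeight_pos ha.pos (k + 1)).le
  have hZ₀ : ∀ k ω, 0 ≤ Z k ω := fun k ω => (abs_nonneg _).trans (hZ k ω y₀ hy₀)
  have he₀ : ∀ k, 0 ≤ ∫ ω, relWeight a (k + 1) * Z k ω ∂μ := fun k =>
    integral_nonneg fun ω => mul_nonneg (hw k) (hZ₀ k ω)
  have hle : ∀ k, ∫ ω, relWeight a (k + 1) * Z k ω ∂μ ≤ c * (relWeight a (k + 1) * rate a k) :=
    fun k => by
      rw [integral_const_mul, mul_left_comm c]
      exact mul_le_mul_of_nonneg_left (hZle k) (hw k)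
  have hsum : Summable fun k => ∫ ω, relWeight a (k + 1) * Z k ω ∂μ :=
    .of_nonneg_of_le he₀ hle (ha.summable_relWeight_mul_rate.mul_left c)
  refine ⟨fun k ω => relWeight a (k + 1) * Z k ω, ∑' k, ∫ ω, relWeight a (k + 1) * Z k ω ∂μ,
    fun k => (hZint k).const_mul _, ?_, fun K => hsum.sum_le_tsum _ fun k _ => he₀ k,
    fun ω k y hy => mul_le_mul_of_nonneg_left ((le_abs_self _).trans (hZ k ω y hy)) (hw k)⟩
  exact ae_summable_of_summable_integral (fun k => (hZint k).const_mul _)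
    (fun k ω => mul_nonneg (hw k) (hZ₀ k ω)) hsum

lemma exists_relWeight_mul_integral_sub_eq (hs : IsIIDSample P μ s) (hx : ∀ k, Measurable (x k))
    (hfresh : ∀ k, Indep (MeasurableSpace.comap (s k) inferInstance) (history s x k) μ)
    (ha : SamplingWeights a) (hc : ∀ t, Continuous fun y => u y t)
    (hm : ∀ y, AEMeasurable (u y) P) (hC : MeasurableSet C) (hM₀ : 0 ≤ M)
    (hM : ∀ y ∈ C, ∀ t, |u y t| ≤ M) :
    ∃ e : ℕ → Ω' → ℝ, (∀ k, Integrable (e k) μ) ∧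
      (∀ᵐ ω ∂μ, ∃ l, Tendsto (fun K => ∑ k ∈ Finset.range K, e k ω) atTop (𝓝 l)) ∧
      (∀ k, ∫ ω, e k ω ∂μ = 0) ∧ ∀ᵐ ω ∂μ, ∀ k, x k ω ∈ C →
        relWeight a k * (∫ t, u (x k ω) t ∂P - u (x k ω) (s k ω)) = e k ω := by
  have := hs.isProbabilityMeasure
  obtain ⟨φ, hφ, hφM, hφ₀, hφu⟩ := exists_measurable_centered hc hm hC hM₀ hM
  have hint : ∀ k, Integrable (fun ω => φ (x k ω) (s k ω)) μ := fun k =>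
    .of_bound (hφ.comp ((hx k).prodMk (hs.measurable k))).aestronglyMeasurable (2 * M)
      (ae_of_all _ fun ω => hφM _ _)
  refine ⟨fun k ω => relWeight a k * φ (x k ω) (s k ω), fun k => (hint k).const_mul _,
    ae_tendsto_sum_comp_iterate_sample hs hx hfresh hφ hφM hφ₀ ha.summable_relWeight_sq,
    fun k => ?_, ae_all_iff.2 fun k => ?_⟩
  · rw [integral_const_mul, integral_comp_iterate_sample_eq_zero hs hx hfresh hφ hφM hφ₀, mul_zero]
  · have hφs : ∀ᵐ ω ∂μ, ∀ y ∈ C, φ y (s k ω) = ∫ t, u y t ∂P - u y (s k ω) :=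
      ae_of_ae_map (hs.measurable k).aemeasurable (by rwa [hs.law k])
    filter_upwards [hφs] with ω hω hxC
    rw [hω _ hxC]

/-- The error of step `k` splits into the sampling error of the average over `s 0, ..., s k`,
dominated by an integrable majorant, and a martingale difference, since `s (k + 1)` is drawn after
`x (k + 1)`. -/
lemma exists_stepError (hs : IsIIDSample P μ s) (hx : ∀ k, Measurable (x k))
    (hfresh : ∀ k, Indep (MeasurableSpace.comap (s k) inferInstance) (history s x k) μ)
    (ha : SamplingWeights a) (hc : ∀ t, Continuous fun y => u y t)
    (hm : ∀ y, AEMeasurable (u y) P) (hC : Bornology.IsBounded C) (hCm : MeasurableSet C)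
    (hne : C.Nonempty) (hM₀ : 0 ≤ M) (hM : ∀ y ∈ C, ∀ t, |u y t| ≤ M)
    (hΛ : ∀ t, LipschitzOnWith Λ (fun y => u y t) C) :
    ∃ e : ℕ → Ω' → ℝ, ∃ B : ℝ, (∀ k, Integrable (e k) μ) ∧
      (∀ᵐ ω ∂μ, ∃ l, Tendsto (fun K => ∑ k ∈ Finset.range K, e k ω) atTop (𝓝 l)) ∧
      (∀ K, ∑ k ∈ Finset.range K, ∫ ω, e k ω ∂μ ≤ B) ∧
      ∀ᵐ ω ∂μ, ∀ k, x (k + 1) ω ∈ C →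
        relWeight a (k + 1) * (samplingError P a u (fun i => s i ω) k (x (k + 1) ω) +
          (∫ t, u (x (k + 1) ω) t ∂P - u (x (k + 1) ω) (s (k + 1) ω))) ≤ e k ω := by
  obtain ⟨e, B, he, hesum, heB, hle⟩ := exists_relWeight_mul_samplingError_le hs ha hm hC hne hM hΛ
  obtain ⟨d, hd, hdconv, hd₀, heq⟩ :=
    exists_relWeight_mul_integral_sub_eq hs hx hfresh ha hc hm hCm hM₀ hM
  refine ⟨fun k ω => e k ω + d (k + 1) ω, B, fun k => (he k).add (hd (k + 1)), ?_, fun K => ?_, ?_⟩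
  · filter_upwards [hesum, hdconv] with ω hω ⟨l, hl⟩
    have hshift : Tendsto (fun K => ∑ k ∈ Finset.range K, d (k + 1) ω) atTop (𝓝 (l - d 0 ω)) := by
      refine (((tendsto_add_atTop_iff_nat 1).2 hl).sub_const (d 0 ω)).congr fun K => ?_
      rw [Finset.sum_range_succ', add_sub_cancel_right]
    simp_rw [Finset.sum_add_distrib]
    exact ⟨_, hω.hasSum.tendsto_sum_nat.add hshift⟩
  · simp_rw [integral_add (he _) (hd _), hd₀, add_zero]
    exact heB K
  · filter_upwards [heq] with ω hω k hxC
    rw [mul_add, hω (k + 1) hxC]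
    exact add_le_add (hle ω k _ hxC) le_rfl

end Noise

end StepError

section Convexity

variable {F : Type*} [AddCommGroup F] [Module ℝ F] {D : Set F}

lemma convexOn_integral {Ω : Type*} [MeasurableSpace Ω] {P : Measure Ω} {u : F → Ω → ℝ}
    (hD : Convex ℝ D) (hu : ∀ t, ConvexOn ℝ D fun x => u x t)
    (hint : ∀ x ∈ D, Integrable (u x) P) : ConvexOn ℝ D fun x => ∫ t, u x t ∂P := by
  refine ⟨hD, fun x hx y hy b c hb hc hbc => ?_⟩
  rw [smul_eq_mul, smul_eq_mul, ← integral_const_mul, ← integral_const_mul,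
    ← integral_add ((hint x hx).const_mul b) ((hint y hy).const_mul c)]
  exact integral_mono (hint _ (hD hx hy hb hc hbc))
    (((hint x hx).const_mul b).add ((hint y hy).const_mul c)) fun t => (hu t).2 hx hy hb hc hbc

lemma convexOn_weightedAvg {a : ℕ → ℝ} (ha : ∀ k, 0 < a k) {f : ℕ → F → ℝ} (hD : Convex ℝ D)
    (hf : ∀ i, ConvexOn ℝ D (f i)) (k : ℕ) :
    ConvexOn ℝ D fun x => weightedAvg a k fun i => f i x := by
  refine ⟨hD, fun x hx y hy b c hb hc hbc => ?_⟩
  have hsmul : ∀ (r : ℝ) (v : ℕ → ℝ), (weightedAvg a k fun i => r • v i) = r • weightedAvg a k v :=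
    fun r v => (map_weightedAvg (LinearMap.lsmul ℝ ℝ r) k v).symm
  refine (weightedAvg_mono ha fun i _ => (hf i).2 hx hy hb hc hbc).trans_eq ?_
  rw [weightedAvg_add, hsmul, hsmul]

end Convexity

lemma rhoConvex_zero_ext {n : ℕ} {ψ : E n → ℝ} (hψ : ConvexOn ℝ Set.univ ψ) :
    RhoConvex 0 (ext ψ) := by
  intro x y b hb hb'
  have := hψ.2 (Set.mem_univ x) (Set.mem_univ y) hb (sub_nonneg.2 hb') (by ring)
  simp only [ext, NNReal.coe_zero, zero_div, zero_mul, EReal.coe_zero, sub_zero]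
  exact_mod_cast this

section Limits

variable {n : ℕ} {ι : Type*} {l : Filter ι} {y : E n}

lemma mem_subdiff_of_tendsto [l.NeBot] {φ : E n → EReal} (hφ : ∀ x, φ x ≠ ⊥)
    (hlsc : LowerSemicontinuous φ) {ξ v : ι → E n} {v₀ : E n} (hξ : Tendsto ξ l (𝓝 y))
    (hv : Tendsto v l (𝓝 v₀)) (hmem : ∀ i, v i ∈ subdiff φ (ξ i)) : v₀ ∈ subdiff φ y := by
  have hlimit : ∀ u, φ u ≠ ⊤ →
      φ y ≠ ⊤ ∧ (φ y).toReal ≤ (φ u).toReal - inner ℝ v₀ (u - y) := fun u hu => by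
    refine ne_top_and_toReal_le_of_tendsto hφ hlsc hξ
      (tendsto_const_nhds.sub (hv.inner (tendsto_const_nhds.sub hξ))) fun i => ?_
    obtain ⟨hi, hle⟩ := (mem_subdiff_iff hφ).1 (hmem i)
    rw [← EReal.coe_toReal hi (hφ _), EReal.coe_le_coe_iff]
    linarith [hle u hu]
  obtain ⟨i⟩ := l.nonempty_of_neBot
  exact (mem_subdiff_iff hφ).2
    ⟨(hlimit _ (hmem i).1).1, fun u hu => by linarith [(hlimit u hu).2]⟩

lemma exists_tendsto_of_norm_le {V : Type*} [SeminormedAddCommGroup V] [ProperSpace V]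
    (U : Ultrafilter ι) {v : ι → V} {R : ℝ} (hv : ∀ i, ‖v i‖ ≤ R) : ∃ v₀, Tendsto v U (𝓝 v₀) := by
  obtain ⟨v₀, -, hv₀⟩ := (isCompact_closedBall (0 : V) R).ultrafilter_le_nhds' (U.map v)
    (Ultrafilter.mem_map.2 (Filter.univ_mem' fun i => mem_closedBall_zero_iff.2 (hv i)))
  exact ⟨v₀, hv₀⟩

end Limits

namespace Program

variable {n : ℕ} {Ω : Type*} [MeasurableSpace Ω] {P : Measure Ω} (p : Program n P)

lemma convexOn_G : ConvexOn ℝ Set.univ p.G :=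
  convexOn_integral convex_univ p.g_convex fun x _ => p.g_integrable x

lemma convexOn_H : ConvexOn ℝ Set.univ p.H :=
  convexOn_integral convex_univ p.h_convex fun x _ => p.h_integrable x

lemma continuous_G : Continuous p.G := continuousOn_univ.1 (p.convexOn_G.continuousOn isOpen_univ)

lemma continuous_H : Continuous p.H := continuousOn_univ.1 (p.convexOn_H.continuousOn isOpen_univ)

/-- The part of the objective that the scheme replaces by a sample average, with the sign
reversed: `h` for the first scheme, `h - g` for the second. -/
def sampled : Scheme → E n → Ω → ℝ
  | .sdca3 => p.h
  | .sdca4 => fun x t => p.h x t - p.g x t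

/-- The objective as a real function; its values are meaningful where `r₁` and `r₂` are finite. -/
def realObjective (x : E n) : ℝ := p.G x - p.H x + (p.r₁ x).toReal - (p.r₂ x).toReal

/-- The objective in which the `sampled` part is averaged over the samples `σ 0, ..., σ k` instead
of the law `P`; it plays the role of a Lyapunov function. -/
def surrogate (alg : Scheme) (a : ℕ → ℝ) (σ : ℕ → Ω) (k : ℕ) (x : E n) : ℝ :=
  p.realObjective x - samplingError P a (p.sampled alg) σ k x

lemma objective_eq {x : E n} (h₁ : p.r₁ x ≠ ⊤) (h₂ : p.r₂ x ≠ ⊤) :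
    p.objective x = (p.realObjective x : EReal) := by
  rw [objective, if_neg h₁, integral_sub (p.g_integrable x) (p.h_integrable x), realObjective, G, H]
  conv_lhs => rw [← EReal.coe_toReal h₁ (p.r₁_ne_bot x), ← EReal.coe_toReal h₂ (p.r₂_ne_bot x)]
  norm_cast
  rw [add_sub_assoc]

lemma continuous_sampled (alg : Scheme) (t : Ω) : Continuous fun x => p.sampled alg x t := by
  cases alg
  · exact p.h_continuous t
  · exact (p.h_continuous t).sub (p.g_continuous t)

lemma aemeasurable_sampled (alg : Scheme) (x : E n) : AEMeasurable (p.sampled alg x) P := by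
  cases alg
  · exact (p.h_integrable x).aemeasurable
  · exact (p.h_integrable x).aemeasurable.sub (p.g_integrable x).aemeasurable

lemma surrogate_eq (alg : Scheme) (a : ℕ → ℝ) (σ : ℕ → Ω) (k : ℕ) (x : E n) :
    p.surrogate alg a σ k x = p.firstComponent a σ k alg x -
      weightedAvg a k (fun i => p.h x (σ i)) + (p.r₁ x).toReal - (p.r₂ x).toReal := by
  cases alg
  · simp only [surrogate, samplingError, sampled, realObjective, firstComponent, H]
    ring
  · simp only [surrogate, samplingError, sampled, realObjective, firstComponent, G, H,
      integral_sub (p.h_integrable x) (p.g_integrable x), weightedAvg_sub]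
    ring

lemma surrogate_succ (alg : Scheme) {a : ℕ → ℝ} (ha : ∀ k, 0 < a k) (σ : ℕ → Ω) (k : ℕ)
    (x : E n) : p.surrogate alg a σ (k + 1) x = p.surrogate alg a σ k x +
      relWeight a (k + 1) * (samplingError P a (p.sampled alg) σ k x +
        (∫ t, p.sampled alg x t ∂P - p.sampled alg x (σ (k + 1)))) := by
  rw [surrogate, surrogate, samplingError, samplingError, weightedAvg_succ ha, relWeight,
    smul_eq_mul]
  ring

variable {p} {alg : Scheme}

lemma FiniteOptimalValue.exists_le_realObjective (hopt : p.FiniteOptimalValue) :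
    ∃ v : ℝ, ∀ y, p.r₁ y ≠ ⊤ → p.r₂ y ≠ ⊤ → v ≤ p.realObjective y := by
  obtain ⟨v, hv⟩ := hopt
  refine ⟨v, fun y h₁ h₂ => ?_⟩
  have hle := iInf_le p.objective y
  rw [hv, p.objective_eq h₁ h₂] at hle
  exact_mod_cast hle

lemma Regular.boundedEquicontinuous_h (hreg : p.Regular alg) : BoundedEquicontinuous p.h := by
  cases alg
  · exact hreg
  · exact hreg.2

lemma Regular.exists_bound_sampled (hreg : p.Regular alg) {C : Set (E n)} (hC : IsCompact C) :
    ∃ M, 0 ≤ M ∧ ∀ x ∈ C, ∀ t, |p.sampled alg x t| ≤ M := by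
  suffices hbound : ∃ M, ∀ x ∈ C, ∀ t, |p.sampled alg x t| ≤ M by
    obtain ⟨M, hM⟩ := hbound
    exact ⟨|M|, abs_nonneg M, fun x hx t => (hM x hx t).trans (le_abs_self M)⟩
  obtain ⟨M, hM⟩ := hreg.boundedEquicontinuous_h.exists_bound hC
  cases alg
  · exact ⟨M, hM⟩
  · obtain ⟨M', hM'⟩ := hreg.1.exists_bound hC
    exact ⟨M + M', fun x hx t => (abs_sub _ _).trans (add_le_add (hM x hx t) (hM' x hx t))⟩

lemma Regular.exists_lipschitz_sampled (hreg : p.Regular alg) (R : ℝ) :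
    ∃ Λ : ℝ≥0, ∀ t, LipschitzOnWith Λ (fun x => p.sampled alg x t) (Metric.closedBall 0 R) := by
  obtain ⟨Λ, hΛ⟩ := hreg.boundedEquicontinuous_h.exists_lipschitz p.h_convex R
  cases alg
  · exact ⟨Λ, hΛ⟩
  · obtain ⟨Λ', hΛ'⟩ := hreg.1.exists_lipschitz p.g_convex R
    exact ⟨Λ + Λ', fun t => (hΛ t).sub (hΛ' t)⟩

lemma exists_rhoConvex (hρ : 0 < p.modulus) :
    ∃ ρ₁ ρ₂ : ℝ≥0, 0 < ρ₁ + ρ₂ ∧ (∀ t, RhoConvex ρ₁ (ext fun x => p.h x t)) ∧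
      RhoConvex ρ₂ p.r₂ := by
  rw [modulus, add_pos_iff] at hρ
  rcases hρ with hρ | hρ
  · obtain ⟨ρ, hpos, hlt⟩ := ENNReal.lt_iff_exists_nnreal_btwn.1 hρ
    exact ⟨ρ, 0, by simpa using hpos,
      fun t => rhoConvex_of_lt_strongConvexityModulus (hlt.trans_le (iInf_le _ t)), p.r₂_convex⟩
  · obtain ⟨ρ, hpos, hlt⟩ := ENNReal.lt_iff_exists_nnreal_btwn.1 hρ
    exact ⟨0, ρ, by simpa using hpos, fun t => rhoConvex_zero_ext (p.h_convex t),
      rhoConvex_of_lt_strongConvexityModulus hlt⟩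

/-- The relations between the iterates of a run, for one outcome; the last one is the variational
inequality that characterizes the minimizers of the convex subproblem. -/
structure IsTrajectory (p : Program n P) (alg : Scheme) (a : ℕ → ℝ) (σ : ℕ → Ω) (x : ℕ → E n)
    (z : ℕ → ℕ → E n) (w : ℕ → E n) : Prop where
  z_mem : ∀ k i : ℕ, i ≤ k → z k i ∈ subdiff (ext fun v => p.h v (σ i)) (x k)
  w_mem : ∀ k : ℕ, w k ∈ subdiff p.r₂ (x k)
  r₁_ne_top : ∀ k, p.r₁ (x k) ≠ ⊤
  optimal : ∀ k y, p.r₁ y ≠ ⊤ →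
    p.firstComponent a σ k alg (x (k + 1)) + (p.r₁ (x (k + 1))).toReal +
        inner ℝ (weightedAvg a k (z k) + w k) (y - x (k + 1)) ≤
      p.firstComponent a σ k alg y + (p.r₁ y).toReal

namespace IsTrajectory

variable {a : ℕ → ℝ} {σ : ℕ → Ω} {x : ℕ → E n} {z : ℕ → ℕ → E n} {w : ℕ → E n}

lemma objective_eq (hT : IsTrajectory p alg a σ x z w) (k : ℕ) :
    p.objective (x k) = (p.realObjective (x k) : EReal) :=
  p.objective_eq (hT.r₁_ne_top k) (hT.w_mem k).1

lemma weightedAvg_add_sq_le (hT : IsTrajectory p alg a σ x z w) (ha : ∀ k, 0 < a k) {ρ : ℝ≥0}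
    (hρ : ∀ t, RhoConvex ρ (ext fun x => p.h x t)) (k : ℕ) (y : E n) :
    weightedAvg a k (fun i => p.h (x k) (σ i)) + inner ℝ (weightedAvg a k (z k)) (y - x k) +
      ρ / 2 * ‖y - x k‖ ^ 2 ≤ weightedAvg a k fun i => p.h y (σ i) := by
  have hsum := weightedAvg_mono ha fun i hi =>
    (hρ (σ i)).add_sq_le_of_ext (hT.z_mem k i hi) y
  rw [weightedAvg_add, weightedAvg_add, weightedAvg_const ha] at hsum
  convert hsum using 3
  rw [real_inner_comm, ← innerₗ_apply_apply, map_weightedAvg]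
  simp only [innerₗ_apply_apply, real_inner_comm]

lemma surrogate_add_sq_le (hT : IsTrajectory p alg a σ x z w) (ha : ∀ k, 0 < a k) {ρ₁ ρ₂ : ℝ≥0}
    (hρ₁ : ∀ t, RhoConvex ρ₁ (ext fun x => p.h x t)) (hρ₂ : RhoConvex ρ₂ p.r₂) (k : ℕ) :
    p.surrogate alg a σ k (x (k + 1)) + (ρ₁ + ρ₂ : ℝ≥0) / 2 * ‖x (k + 1) - x k‖ ^ 2 ≤
      p.surrogate alg a σ k (x k) := by
  have havg := hT.weightedAvg_add_sq_le ha hρ₁ k (x (k + 1))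
  have hr₂ := hρ₂.add_sq_le p.r₂_ne_bot (hT.w_mem k) (hT.w_mem (k + 1)).1
  have hopt := hT.optimal k (x k) (hT.r₁_ne_top k)
  rw [← neg_sub (x (k + 1)), inner_neg_right, inner_add_left] at hopt
  rw [surrogate_eq, surrogate_eq]
  push_cast
  linarith

lemma surrogate_succ_le (hT : IsTrajectory p alg a σ x z w) (ha : ∀ k, 0 < a k) {ρ₁ ρ₂ : ℝ≥0}
    (hρ₁ : ∀ t, RhoConvex ρ₁ (ext fun x => p.h x t)) (hρ₂ : RhoConvex ρ₂ p.r₂) (k : ℕ) :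
    p.surrogate alg a σ (k + 1) (x (k + 1)) ≤
      p.surrogate alg a σ k (x k) - (ρ₁ + ρ₂ : ℝ≥0) / 2 * ‖x (k + 1) - x k‖ ^ 2 +
        relWeight a (k + 1) * (samplingError P a (p.sampled alg) σ k (x (k + 1)) +
          (∫ t, p.sampled alg (x (k + 1)) t ∂P - p.sampled alg (x (k + 1)) (σ (k + 1)))) := by
  rw [p.surrogate_succ alg ha]
  linarith [hT.surrogate_add_sq_le ha hρ₁ hρ₂ k]

variable {l : Filter ℕ} [l.NeBot] {y Y w₀ : E n}

lemma mem_subdiff_H (hT : IsTrajectory p alg a σ x z w) (ha : ∀ k, 0 < a k)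
    (hH : TendstoLocallyUniformly (fun k v => weightedAvg a k fun i => p.h v (σ i)) p.H l)
    (hx : Tendsto x l (𝓝 y)) (hY : Tendsto (fun k => weightedAvg a k (z k)) l (𝓝 Y)) :
    Y ∈ subdiff (ext p.H) y := by
  refine mem_subdiff_ext_iff.2 fun v => ?_
  have hHx := hH.tendsto_comp p.continuous_H.continuousAt hx
  have hHv := hH.tendsto_comp p.continuous_H.continuousAt (tendsto_const_nhds (x := v))
  refine le_of_tendsto_of_tendsto' (hHx.add (hY.inner (tendsto_const_nhds.sub hx))) hHv fun k => ?_
  simpa using hT.weightedAvg_add_sq_le ha (fun t => rhoConvex_zero_ext (p.h_convex t)) k v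

lemma exists_add_mem_subdiff_G (hT : IsTrajectory p alg a σ x z w)
    (hG : TendstoLocallyUniformly (fun k => p.firstComponent a σ k alg) p.G l)
    (hx : Tendsto (fun k => x (k + 1)) l (𝓝 y))
    (hY : Tendsto (fun k => weightedAvg a k (z k)) l (𝓝 Y)) (hw : Tendsto w l (𝓝 w₀)) :
    ∃ u₁ ∈ subdiff (ext p.G) y, ∃ u₂ ∈ subdiff p.r₁ y, u₁ + u₂ = Y + w₀ := by
  have hlimit : ∀ v, p.r₁ v ≠ ⊤ → p.r₁ y ≠ ⊤ ∧
      (p.r₁ y).toReal ≤ p.G v + (p.r₁ v).toReal - p.G y - inner ℝ (Y + w₀) (v - y) := fun v hv => by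
    have hGx := hG.tendsto_comp p.continuous_G.continuousAt hx
    have hGv := hG.tendsto_comp p.continuous_G.continuousAt (tendsto_const_nhds (x := v))
    refine ne_top_and_toReal_le_of_tendsto p.r₁_ne_bot p.r₁_lsc hx
      (((hGv.add_const _).sub hGx).sub ((hY.add hw).inner (tendsto_const_nhds.sub hx))) fun k => ?_
    rw [← EReal.coe_toReal (hT.r₁_ne_top (k + 1)) (p.r₁_ne_bot _), EReal.coe_le_coe_iff]
    linarith [hT.optimal k v hv]
  refine exists_add_mem_subdiff p.convexOn_G p.continuous_G p.r₁_ne_bot p.r₁_convex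
    (hlimit _ (hT.r₁_ne_top 0)).1 fun v hv => ?_
  linarith [(hlimit v hv).2]

lemma norm_weightedAvg_le_of_norm_le (hT : IsTrajectory p alg a σ x z w) (ha : ∀ k, 0 < a k)
    {R M : ℝ} (hR : ∀ k, ‖x k‖ ≤ R) (hM : ∀ v ∈ Metric.closedBall 0 (R + 1), ∀ t, |p.h v t| ≤ M)
    (k : ℕ) : ‖weightedAvg a k (z k)‖ ≤ 2 * M :=
  norm_weightedAvg_le ha fun i hi => norm_le_of_mem_subdiff_ext (hT.z_mem k i hi) fun v hv =>
    hM v (Metric.closedBall_subset_closedBall' (by rw [dist_zero_right]; linarith [hR k]) hv) (σ i)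

lemma isCritical_of_mapClusterPt (hT : IsTrajectory p alg a σ x z w) (ha : ∀ k, 0 < a k)
    (hreg : p.Regular alg)
    (hH : TendstoLocallyUniformly (fun k v => weightedAvg a k fun i => p.h v (σ i)) p.H atTop)
    (hG : TendstoLocallyUniformly (fun k => p.firstComponent a σ k alg) p.G atTop)
    {R : ℝ} (hR : ∀ k, ‖x k‖ ≤ R) (hΔ : Tendsto (fun k => x (k + 1) - x k) atTop (𝓝 0))
    {W : ℝ} (hW : ∀ k, ‖w k‖ ≤ W) {y : E n} (hy : MapClusterPt y atTop x) : p.IsCritical y := by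
  obtain ⟨U, hU, hx⟩ := mapClusterPt_iff_ultrafilter.1 hy
  have hmono : ∀ {F : ℕ → E n → ℝ} {f}, TendstoLocallyUniformly F f atTop →
      TendstoLocallyUniformly F f U := fun h u hu v =>
    (h u hu v).imp fun _ ht => ⟨ht.1, ht.2.filter_mono hU⟩
  have hx' : Tendsto (fun k => x (k + 1)) U (𝓝 y) := by
    simpa using (hΔ.mono_left hU).add hx
  obtain ⟨M, hM⟩ := hreg.boundedEquicontinuous_h.exists_bound (isCompact_closedBall 0 (R + 1))
  obtain ⟨Y, hY⟩ := exists_tendsto_of_norm_le U (hT.norm_weightedAvg_le_of_norm_le ha hR hM)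
  obtain ⟨w₀, hw₀⟩ := exists_tendsto_of_norm_le U hW
  have hYsub := hT.mem_subdiff_H ha (hmono hH) hx hY
  have hwsub := mem_subdiff_of_tendsto p.r₂_ne_bot p.r₂_lsc hx hw₀ hT.w_mem
  obtain ⟨u₁, hu₁, u₂, hu₂, hu⟩ := hT.exists_add_mem_subdiff_G (hmono hG) hx' hY hw₀
  have hzero : u₁ + u₂ - Y - w₀ = 0 := by
    rw [hu]
    abel
  rw [IsCritical, ← hzero]
  exact Set.sub_mem_sub (Set.sub_mem_sub (Set.add_mem_add hu₁ hu₂) hYsub) hwsub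

end IsTrajectory

end Program

section Convergence

variable {n : ℕ} {Ω : Type*} [MeasurableSpace Ω] {P : Measure Ω} {Ω' : Type*} [MeasurableSpace Ω']
  {μ : Measure Ω'} {a : ℕ → ℝ} {s : ℕ → Ω' → Ω}

lemma IsIIDSample.ae_tendstoLocallyUniformly_weightedAvg [IsProbabilityMeasure μ]
    (hs : IsIIDSample P μ s) (ha : SamplingWeights a) {u : E n → Ω → ℝ}
    (hc : ∀ t, ConvexOn ℝ Set.univ fun x => u x t) (hm : ∀ x, AEMeasurable (u x) P)
    (hu : BoundedEquicontinuous u) :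
    ∀ᵐ ω ∂μ, TendstoLocallyUniformly (fun k x => weightedAvg a k fun i => u x (s i ω))
      (fun x => ∫ t, u x t ∂P) atTop := by
  have hball : ∀ R : ℕ, ∀ᵐ ω ∂μ, TendstoUniformlyOn (samplingError P a u fun i => s i ω) 0 atTop
      (Metric.closedBall 0 R) := fun R => by
    obtain ⟨M, hM⟩ := hu.exists_bound (isCompact_closedBall (0 : E n) R)
    obtain ⟨Λ, hΛ⟩ := hu.exists_lipschitz hc R
    exact hs.ae_tendstoUniformlyOn_samplingError ha (isCompact_closedBall 0 _).totallyBounded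
      (fun x _ => hm x) hM hΛ
  filter_upwards [ae_all_iff.2 hball] with ω hω
  refine Metric.tendstoLocallyUniformly_iff.2 fun ε hε x => ?_
  obtain ⟨R, hR⟩ := exists_nat_gt ‖x‖
  refine ⟨Metric.closedBall 0 R, Metric.closedBall_mem_nhds_of_mem (by simpa using hR), ?_⟩
  filter_upwards [Metric.tendstoUniformlyOn_iff.1 (hω R) ε hε] with k hk y hy
  simpa [samplingError, Real.dist_eq, abs_sub_comm] using hk y hy

namespace IsRun

variable {p : Program n P} {alg : Scheme} {x₀ : E n} {x : ℕ → Ω' → E n} {z : ℕ → ℕ → Ω' → E n}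
  {w : ℕ → Ω' → E n}

lemma isIIDSample (hrun : IsRun p alg a μ x₀ s x z w) : IsIIDSample P μ s :=
  ⟨hrun.sample_measurable, hrun.sample_law, hrun.sample_indep⟩

lemma ae_isTrajectory (hrun : IsRun p alg a μ x₀ s x z w) :
    ∀ᵐ ω ∂μ, p.IsTrajectory alg a (fun i => s i ω) (fun k => x k ω) (fun k i => z k i ω)
      fun k => w k ω := by
  filter_upwards [hrun.z_mem, hrun.w_mem, hrun.step] with ω hz hw hstep
  have hstart : p.r₁ (x 0 ω) ≠ ⊤ := hrun.start_eq ω ▸ hrun.start_mem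
  have hfinite : ∀ k, p.r₁ (x k ω) ≠ ⊤
    | 0 => hstart
    | k + 1 => ne_top_of_isMinOn p.r₁_ne_bot (hstep k) hstart
  exact ⟨hz, hw, hfinite, fun k y hy => add_inner_le_of_isMinOn p.r₁_ne_bot (hstep k) hy⟩

variable [IsProbabilityMeasure μ]

lemma ae_tendstoLocallyUniformly_firstComponent (hrun : IsRun p alg a μ x₀ s x z w)
    (ha : SamplingWeights a) (hreg : p.Regular alg) :
    ∀ᵐ ω ∂μ, TendstoLocallyUniformly (fun k => p.firstComponent a (fun i => s i ω) k alg)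
      p.G atTop := by
  cases alg
  · refine ae_of_all _ fun ω U hU v => ⟨Set.univ, univ_mem, ?_⟩
    exact Eventually.of_forall fun _ y _ => refl_mem_uniformity hU
  · exact hrun.isIIDSample.ae_tendstoLocallyUniformly_weightedAvg ha p.g_convex
      (fun v => (p.g_integrable v).aemeasurable) hreg.1

lemma ae_isCritical (hrun : IsRun p alg a μ x₀ s x z w) (ha : SamplingWeights a)
    (hreg : p.Regular alg) (hbdd : ∀ᵐ ω ∂μ, BddAbove (Set.range fun k => ‖x k ω‖))
    (hsum : ∀ᵐ ω ∂μ, Summable fun k => ‖x (k + 1) ω - x k ω‖ ^ 2) :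
    ∀ᵐ ω ∂μ, BddAbove (Set.range fun k => ‖w k ω‖) →
      ∀ y : E n, MapClusterPt y atTop (fun k => x k ω) → p.IsCritical y := by
  have hH := hrun.isIIDSample.ae_tendstoLocallyUniformly_weightedAvg ha p.h_convex
    (fun v => (p.h_integrable v).aemeasurable) hreg.boundedEquicontinuous_h
  have hG := hrun.ae_tendstoLocallyUniformly_firstComponent ha hreg
  filter_upwards [hrun.ae_isTrajectory, hbdd, hsum, hH, hG]
    with ω hT ⟨R, hR⟩ hsum hH hG ⟨W, hW⟩ y hy
  have hΔ : Tendsto (fun k => x (k + 1) ω - x k ω) atTop (𝓝 0) := by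
    refine tendsto_zero_iff_norm_tendsto_zero.2 ?_
    simpa using hsum.tendsto_atTop_zero.sqrt
  exact hT.isCritical_of_mapClusterPt ha.pos hreg hH hG (fun k => hR ⟨k, rfl⟩) hΔ
    (fun k => hW ⟨k, rfl⟩) hy

lemma exists_surrogate_descent (hrun : IsRun p alg a μ x₀ s x z w) (ha : SamplingWeights a)
    (hreg : p.Regular alg) (hopt : p.FiniteOptimalValue) (hρ : 0 < p.modulus) {C : Set (E n)}
    (hC : IsCompact C) (hne : C.Nonempty) :
    ∃ ρ b B : ℝ, ∃ e : ℕ → Ω' → ℝ, 0 < ρ ∧ (∀ k, Integrable (e k) μ) ∧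
      (∀ᵐ ω ∂μ, ∃ l, Tendsto (fun K => ∑ k ∈ Finset.range K, e k ω) atTop (𝓝 l)) ∧
      (∀ K, ∑ k ∈ Finset.range K, ∫ ω, e k ω ∂μ ≤ B) ∧
      ∀ᵐ ω ∂μ, (∀ k, x k ω ∈ C) → ∀ k, b ≤ p.surrogate alg a (fun i => s i ω) k (x k ω) ∧
        p.surrogate alg a (fun i => s i ω) (k + 1) (x (k + 1) ω) ≤
          p.surrogate alg a (fun i => s i ω) k (x k ω) - ρ * ‖x (k + 1) ω - x k ω‖ ^ 2 + e k ω := by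
  have := hrun.isIIDSample.isProbabilityMeasure
  obtain ⟨v, hv⟩ := hopt.exists_le_realObjective
  obtain ⟨ρ₁, ρ₂, hρpos, hρ₁, hρ₂⟩ := Program.exists_rhoConvex hρ
  obtain ⟨M, hM₀, hM⟩ := hreg.exists_bound_sampled hC
  obtain ⟨R, hCR⟩ := hC.isBounded.subset_closedBall 0
  obtain ⟨Λ, hΛ⟩ := hreg.exists_lipschitz_sampled R
  obtain ⟨e, B, he, hconv, hB, hle⟩ := exists_stepError hrun.isIIDSample hrun.iterate_measurable
    hrun.sample_fresh ha (p.continuous_sampled alg) (p.aemeasurable_sampled alg) hC.isBounded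
    hC.measurableSet hne hM₀ hM fun t => (hΛ t).mono hCR
  refine ⟨(ρ₁ + ρ₂ : ℝ≥0) / 2, v - 2 * M, B, e, by positivity, he, hconv, hB, ?_⟩
  filter_upwards [hrun.ae_isTrajectory, hle] with ω hT hle hxC k
  refine ⟨?_, (hT.surrogate_succ_le ha.pos hρ₁ hρ₂ k).trans (by gcongr; exact hle k (hxC (k + 1)))⟩
  have herr := abs_samplingError_le (P := P) ha.pos (hM _ (hxC k)) (fun i => s i ω) k
  exact sub_le_sub (hv _ (hT.r₁_ne_top k) (hT.w_mem k).1) ((le_abs_self _).trans herr)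

lemma ae_tendsto_samplingError (hrun : IsRun p alg a μ x₀ s x z w) (ha : SamplingWeights a)
    (hreg : p.Regular alg) {C : Set (E n)} (hC : IsCompact C) :
    ∀ᵐ ω ∂μ, (∀ k, x k ω ∈ C) →
      Tendsto (fun k => samplingError P a (p.sampled alg) (fun i => s i ω) k (x k ω))
        atTop (𝓝 0) := by
  obtain ⟨M, -, hM⟩ := hreg.exists_bound_sampled hC
  obtain ⟨R, hCR⟩ := hC.isBounded.subset_closedBall 0
  obtain ⟨Λ, hΛ⟩ := hreg.exists_lipschitz_sampled R
  filter_upwards [hrun.isIIDSample.ae_tendstoUniformlyOn_samplingError ha hC.totallyBounded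
    (fun y _ => p.aemeasurable_sampled alg y) hM fun t => (hΛ t).mono hCR] with ω hω hxC
  refine Metric.tendsto_nhds.2 fun ε hε => ?_
  filter_upwards [Metric.tendstoUniformlyOn_iff.1 hω ε hε] with k hk
  simpa [dist_comm] using hk _ (hxC k)

lemma ae_tendsto_and_summable_of_isCompact (hrun : IsRun p alg a μ x₀ s x z w)
    (ha : SamplingWeights a) (hreg : p.Regular alg) (hopt : p.FiniteOptimalValue)
    (hρ : 0 < p.modulus) {C : Set (E n)} (hC : IsCompact C) :
    ∀ᵐ ω ∂μ, (∀ k, x k ω ∈ C) →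
      (∃ l : ℝ, Tendsto (fun k => p.objective (x k ω)) atTop (𝓝 (l : EReal))) ∧
      Summable fun k => ‖x (k + 1) ω - x k ω‖ ^ 2 := by
  obtain rfl | hne := C.eq_empty_or_nonempty
  · exact ae_of_all _ fun ω hω => (hω 0).elim
  obtain ⟨ρ, b, -, e, hρpos, -, hconv, -, hdescent⟩ :=
    hrun.exists_surrogate_descent ha hreg hopt hρ hC hne
  filter_upwards [hrun.ae_isTrajectory, hconv, hdescent, hrun.ae_tendsto_samplingError ha hreg hC]
    with ω hT ⟨c, hc⟩ hdescent herr hxC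
  obtain ⟨⟨l, hl⟩, hsum⟩ := tendsto_and_summable_of_le
    (v := fun k => p.surrogate alg a (fun i => s i ω) k (x k ω)) (fun k => by positivity)
    (fun k => (hdescent hxC k).2) (fun k => (hdescent hxC k).1) hc
  refine ⟨⟨l, ?_⟩, (summable_mul_left_iff hρpos.ne').1 hsum⟩
  have hreal : Tendsto (fun k => p.realObjective (x k ω)) atTop (𝓝 l) := by
    simpa [Program.surrogate] using hl.add (herr hxC)
  simp_rw [hT.objective_eq]
  exact (continuous_coe_real_ereal.tendsto l).comp hreal

lemma ae_tendsto_and_summable (hrun : IsRun p alg a μ x₀ s x z w) (ha : SamplingWeights a)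
    (hreg : p.Regular alg) (hopt : p.FiniteOptimalValue)
    (hbdd : ∀ᵐ ω ∂μ, BddAbove (Set.range fun k => ‖x k ω‖)) (hρ : 0 < p.modulus) :
    ∀ᵐ ω ∂μ, (∃ l : ℝ, Tendsto (fun k => p.objective (x k ω)) atTop (𝓝 (l : EReal))) ∧
      Summable fun k => ‖x (k + 1) ω - x k ω‖ ^ 2 := by
  have hball : ∀ R : ℕ, ∀ᵐ ω ∂μ, (∀ k, x k ω ∈ Metric.closedBall 0 R) → _ := fun R =>
    hrun.ae_tendsto_and_summable_of_isCompact ha hreg hopt hρ (isCompact_closedBall 0 (R : ℝ))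
  filter_upwards [hbdd, ae_all_iff.2 hball] with ω ⟨B, hB⟩ hω
  obtain ⟨R, hR⟩ := exists_nat_ge B
  exact hω R fun k => mem_closedBall_zero_iff.2 ((hB ⟨k, rfl⟩).trans hR)

end IsRun

end Convergence

section VectorSampling

variable {Ω : Type*} [MeasurableSpace Ω] {P : Measure Ω} {Ω' : Type*} [MeasurableSpace Ω']
  {μ : Measure Ω'} {a : ℕ → ℝ} {s : ℕ → Ω' → Ω} {V : Type*} [NormedAddCommGroup V]
  [InnerProductSpace ℝ V]

lemma norm_le_sum_abs_inner {ι : Type*} [Fintype ι] (b : OrthonormalBasis ι ℝ V) (v : V) :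
    ‖v‖ ≤ ∑ j, |inner ℝ (b j) v| := by
  conv_lhs => rw [← b.sum_repr' v]
  exact (norm_sum_le _ _).trans_eq (by simp [norm_smul])

variable [FiniteDimensional ℝ V]

lemma inner_samplingError {X : Type*} {u : X → Ω → V} {x : X} (hu : Integrable (u x) P) (v : V)
    (σ : ℕ → Ω) (k : ℕ) :
    inner ℝ v (samplingError P a u σ k x) =
      samplingError P a (fun y t => inner ℝ v (u y t)) σ k x := by
  rw [samplingError, samplingError, inner_sub_right, integral_inner hu, ← innerₗ_apply_apply,
    map_weightedAvg]
  simp only [innerₗ_apply_apply]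

lemma IsIIDSample.exists_integral_norm_samplingError_le [IsProbabilityMeasure μ] {F : Type*}
    [NormedAddCommGroup F] [NormedSpace ℝ F] [FiniteDimensional ℝ F] {u : F → Ω → V} {C : Set F}
    {M : ℝ} {Λ : ℝ≥0} (hs : IsIIDSample P μ s) (ha : ∀ k, 0 < a k) (hC : Bornology.IsBounded C)
    (hm : ∀ x ∈ C, AEStronglyMeasurable (u x) P) (hM : ∀ x ∈ C, ∀ t, ‖u x t‖ ≤ M)
    (hΛ : ∀ t, LipschitzOnWith Λ (fun x => u x t) C) :
    ∃ c : ℝ, ∀ k, ∃ Z : Ω' → ℝ, Integrable Z μ ∧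
      (∀ ω, ∀ x ∈ C, ‖samplingError P a u (fun i => s i ω) k x‖ ≤ Z ω) ∧
      ∫ ω, Z ω ∂μ ≤ c * rate a k := by
  have := hs.isProbabilityMeasure
  set b := stdOrthonormalBasis ℝ V
  have hinner (j) (v : V) : |inner ℝ (b j) v| ≤ ‖v‖ := by
    simpa using abs_real_inner_le_norm (b j) v
  have hcoord := fun j => hs.exists_integral_samplingError_le
    (u := fun x t => inner ℝ (b j) (u x t)) ha hC
    (fun x hx => (aestronglyMeasurable_const.inner (hm x hx)).aemeasurable)
    (fun x hx t => (hinner j _).trans (hM x hx t)) fun t => .of_dist_le_mul fun x hx y hy => by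
      rw [Real.dist_eq, ← inner_sub_right]
      exact (hinner j _).trans (by simpa [dist_eq_norm] using (hΛ t).dist_le_mul x hx y hy)
  choose c hc using hcoord
  refine ⟨∑ j, c j, fun k => ?_⟩
  choose Z hZint hZ hZle using fun j => hc j k
  refine ⟨fun ω => ∑ j, Z j ω, integrable_finsetSum _ fun j _ => hZint j, fun ω x hx => ?_, ?_⟩
  · refine (norm_le_sum_abs_inner b _).trans (Finset.sum_le_sum fun j _ => ?_)
    rw [inner_samplingError (.of_bound (hm x hx) M (ae_of_all _ (hM x hx)))]
    exact hZ j ω x hx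
  · rw [integral_finsetSum _ fun j _ => hZint j, Finset.sum_mul]
    exact Finset.sum_le_sum fun j _ => hZle j

lemma aestronglyMeasurable_gradient {u : V → Ω → ℝ} (hm : ∀ y, AEMeasurable (u y) P) {x : V}
    (hd : ∀ t, DifferentiableAt ℝ (fun y => u y t) x) :
    AEStronglyMeasurable (fun t => gradient (fun y => u y t) x) P := by
  have hinner (v : V) : AEMeasurable (fun t => inner ℝ v (gradient (fun y => u y t) x)) P := by
    have hstep : Tendsto (fun m : ℕ => 1 / ((m : ℝ) + 1)) atTop (𝓝[>] 0) :=
      tendsto_nhdsWithin_iff.2 ⟨tendsto_one_div_add_atTop_nhds_zero_nat,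
        Eventually.of_forall fun m => Set.mem_Ioi.2 (by positivity)⟩
    refine aemeasurable_of_tendsto_metrizable_ae atTop
      (fun m : ℕ => ((hm (x + (1 / ((m : ℝ) + 1)) • v)).sub (hm x)).const_mul (1 / ((m : ℝ) + 1))⁻¹)
      (ae_of_all _ fun t => ?_)
    have hline := (hd t).hasGradientAt.hasFDerivAt.hasLineDerivAt v
    rw [InnerProductSpace.toDual_apply_apply, real_inner_comm] at hline
    exact hline.tendsto_slope_zero_right.comp hstep
  set b := stdOrthonormalBasis ℝ V
  have hrepr : (fun t => gradient (fun y => u y t) x) =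
      fun t => ∑ j, inner ℝ (b j) (gradient (fun y => u y t) x) • b j :=
    funext fun t => (b.sum_repr' _).symm
  rw [hrepr]
  exact Finset.aestronglyMeasurable_fun_sum _ fun j _ =>
    (hinner (b j)).aestronglyMeasurable.smul_const (b j)

end VectorSampling

section GradientSampling

variable {n : ℕ} {Ω : Type*} {u : E n → Ω → ℝ} {C : Set (E n)}

lemma BoundedEquicontinuous.exists_bound_norm_subgradient (hu : BoundedEquicontinuous u)
    (hC : Bornology.IsBounded C) :
    ∃ M : ℝ, ∀ x ∈ C, ∀ t, ∀ v ∈ subdiff (ext fun y => u y t) x, ‖v‖ ≤ M := by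
  obtain ⟨R, hCR⟩ := hC.subset_closedBall 0
  obtain ⟨M, hM⟩ := hu.exists_bound (isCompact_closedBall (0 : E n) (R + 1))
  refine ⟨2 * M, fun x hx t v hv => norm_le_of_mem_subdiff_ext hv fun y hy => hM y ?_ t⟩
  refine Metric.closedBall_subset_closedBall' ?_ hy
  linarith [Metric.mem_closedBall.1 (hCR hx)]

variable [MeasurableSpace Ω] {P : Measure Ω}

lemma integral_mem_subdiff_ext [IsProbabilityMeasure P] (hu : ∀ y, Integrable (u y) P) {x : E n}
    {v : Ω → E n} (hv : Integrable v P) (hmem : ∀ t, v t ∈ subdiff (ext fun y => u y t) x) :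
    ∫ t, v t ∂P ∈ subdiff (ext fun y => ∫ t, u y t ∂P) x := by
  refine mem_subdiff_ext_iff.2 fun y => ?_
  have hinner := hv.const_inner (𝕜 := ℝ) (y - x)
  rw [real_inner_comm, ← integral_inner hv, ← integral_add (hu x) hinner]
  refine integral_mono ((hu x).add hinner) (hu y) fun t => ?_
  simpa [real_inner_comm] using mem_subdiff_ext_iff.1 (hmem t) y

lemma hasGradientAt_weightedAvg (a : ℕ → ℝ) (k : ℕ) {F : Type*} [NormedAddCommGroup F]
    [InnerProductSpace ℝ F] [CompleteSpace F] {φ : ℕ → F → ℝ} {x : F}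
    (hd : ∀ i, DifferentiableAt ℝ (φ i) x) :
    HasGradientAt (fun v => weightedAvg a k fun i => φ i v)
      (weightedAvg a k fun i => gradient (φ i) x) x := by
  rw [hasGradientAt_iff_hasFDerivAt]
  have hsum := (HasFDerivAt.fun_sum (u := Finset.range (k + 1)) fun i _ =>
    ((hd i).hasGradientAt.hasFDerivAt.const_smul (a i))).const_smul (weightSum a k)⁻¹
  exact hsum.congr_fderiv (by simp [weightedAvg, map_smul, map_sum])

lemma IsIIDSample.exists_integral_weightedAvg_gradient_sub_le {Ω' : Type*} [MeasurableSpace Ω']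
    {μ : Measure Ω'} [IsProbabilityMeasure μ] {a : ℕ → ℝ} {s : ℕ → Ω' → Ω}
    (hs : IsIIDSample P μ s) (ha : ∀ k, 0 < a k) (hc : ∀ t, ConvexOn ℝ Set.univ fun x => u x t)
    (hcont : ∀ t, Continuous fun x => u x t) (hi : ∀ y, Integrable (u y) P)
    (hu : BoundedEquicontinuous u) (hC : Bornology.IsBounded C) {K : ℝ≥0}
    (hK : ∀ t, HasLipschitzGradientOn (ext fun x => u x t) K C) :
    ∃ c : ℝ, ∀ k, ∃ Z : Ω' → ℝ, Integrable Z μ ∧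
      (∀ ω, ∀ y ∈ C, ∃ v ∈ subdiff (ext fun y => ∫ t, u y t ∂P) y,
        ‖weightedAvg a k (fun i => gradient (fun y => u y (s i ω)) y) - v‖ ≤ Z ω) ∧
      ∫ ω, Z ω ∂μ ≤ c * rate a k := by
  have := hs.isProbabilityMeasure
  have hd : ∀ y ∈ C, ∀ t, DifferentiableAt ℝ (fun y => u y t) y := fun y hy t => ((hK t).1 y hy).2
  have hsub : ∀ y ∈ C, ∀ t, gradient (fun y => u y t) y ∈ subdiff (ext fun y => u y t) y :=
    fun y hy t => gradient_mem_subdiff_ext (hc t) (hcont t) (hd y hy t)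
  have hmeas : ∀ y ∈ C, AEStronglyMeasurable (fun t => gradient (fun y => u y t) y) P :=
    fun y hy => aestronglyMeasurable_gradient (fun y => (hi y).aemeasurable) (hd y hy)
  obtain ⟨M, hM⟩ := hu.exists_bound_norm_subgradient hC
  have hbound : ∀ y ∈ C, ∀ t, ‖gradient (fun y => u y t) y‖ ≤ M :=
    fun y hy t => hM y hy t _ (hsub y hy t)
  obtain ⟨c, hc⟩ := hs.exists_integral_norm_samplingError_le ha hC hmeas hbound fun t => (hK t).2
  refine ⟨c, fun k => (hc k).imp fun Z hZ => ⟨hZ.1, fun ω y hy => ⟨_, ?_, hZ.2.1 ω y hy⟩, hZ.2.2⟩⟩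
  exact integral_mem_subdiff_ext hi (.of_bound (hmeas y hy) M (ae_of_all _ (hbound y hy)))
    (hsub y hy)

end GradientSampling

lemma HasLipschitzGradientOn.norm_sub_le {n : ℕ} {φ : E n → EReal} {K : ℝ≥0} {C : Set (E n)}
    (h : HasLipschitzGradientOn φ K C) (hφ : ∀ x, φ x ≠ ⊥) {x y v v' : E n} (hx : x ∈ C)
    (hy : y ∈ C) (hv : v ∈ subdiff φ x) (hv' : v' ∈ subdiff φ y) : ‖v - v'‖ ≤ K * ‖x - y‖ := by
  rw [h.eq_gradient hφ hx hv, h.eq_gradient hφ hy hv', ← dist_eq_norm, ← dist_eq_norm]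
  exact h.2.dist_le_mul x hx y hy

section Residual

variable {n : ℕ} {Ω : Type*} [MeasurableSpace Ω] {P : Measure Ω} {p : Program n P} {alg : Scheme}
  {a : ℕ → ℝ} {C : Set (E n)} {L : ℝ≥0}

namespace Program

lemma convexOn_firstComponent (p : Program n P) (ha : ∀ k, 0 < a k) (σ : ℕ → Ω) (k : ℕ)
    (alg : Scheme) : ConvexOn ℝ Set.univ (p.firstComponent a σ k alg) := by
  cases alg
  · exact p.convexOn_G
  · exact convexOn_weightedAvg ha convex_univ (fun i => p.g_convex (σ i)) k

lemma EquiLipschitzGradients.r₂ (hL : p.EquiLipschitzGradients L C alg) :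
    HasLipschitzGradientOn p.r₂ (L / 2) C := by
  cases alg
  · exact hL.1
  · exact hL.1

lemma EquiLipschitzGradients.h (hL : p.EquiLipschitzGradients L C alg) (t : Ω) :
    HasLipschitzGradientOn (ext fun x => p.h x t) (L / 2) C := by
  cases alg
  · exact hL.2 t
  · exact hL.2.1 t

namespace IsTrajectory

variable {σ : ℕ → Ω} {x : ℕ → E n} {z : ℕ → ℕ → E n} {w : ℕ → E n}

lemma exists_add_mem_subdiff_firstComponent (hT : IsTrajectory p alg a σ x z w)
    (ha : ∀ k, 0 < a k) (k : ℕ) :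
    ∃ u₁ ∈ subdiff (ext (p.firstComponent a σ k alg)) (x (k + 1)),
      ∃ u₂ ∈ subdiff p.r₁ (x (k + 1)), u₁ + u₂ = weightedAvg a k (z k) + w k :=
  have hconv := p.convexOn_firstComponent ha σ k alg
  exists_add_mem_subdiff hconv (continuousOn_univ.1 (hconv.continuousOn isOpen_univ))
    p.r₁_ne_bot p.r₁_convex (hT.r₁_ne_top (k + 1)) (hT.optimal k)

lemma norm_weightedAvg_sub_gradient_le (hT : IsTrajectory p alg a σ x z w) (ha : ∀ k, 0 < a k)
    (hL : p.EquiLipschitzGradients L C alg) {k : ℕ} (hk : x k ∈ C) (hk' : x (k + 1) ∈ C) :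
    ‖weightedAvg a k (z k) -
        weightedAvg a k fun i => gradient (fun y => p.h y (σ i)) (x (k + 1))‖ ≤
      (L / 2 : ℝ≥0) * ‖x k - x (k + 1)‖ := by
  rw [← weightedAvg_sub]
  exact norm_weightedAvg_le ha fun i hi => (hL.h (σ i)).norm_sub_le (fun _ => EReal.coe_ne_bot _)
    hk hk' (hT.z_mem k i hi)
    (gradient_mem_subdiff_ext (p.h_convex _) (p.h_continuous _) ((hL.h (σ i)).1 _ hk').2)

lemma exists_mem_residual_norm_le (hT : IsTrajectory p alg a σ x z w) (ha : ∀ k, 0 < a k)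
    (hL : p.EquiLipschitzGradients L C alg) {k : ℕ} (hk : x k ∈ C) (hk' : x (k + 1) ∈ C)
    {ε₁ ε₂ : ℝ}
    (hG : ∀ u ∈ subdiff (ext (p.firstComponent a σ k alg)) (x (k + 1)),
      ∃ v ∈ subdiff (ext p.G) (x (k + 1)), ‖u - v‖ ≤ ε₁)
    (hH : ∃ v ∈ subdiff (ext p.H) (x (k + 1)),
      ‖(weightedAvg a k fun i => gradient (fun y => p.h y (σ i)) (x (k + 1))) - v‖ ≤ ε₂) :
    ∃ v ∈ p.residual (x (k + 1)), ‖v‖ ≤ ε₁ + ε₂ + L * ‖x (k + 1) - x k‖ := by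
  obtain ⟨u₁, hu₁, u₂, hu₂, hu⟩ := hT.exists_add_mem_subdiff_firstComponent ha k
  obtain ⟨v₁, hv₁, hε₁⟩ := hG u₁ hu₁
  obtain ⟨v₂, hv₂, hε₂⟩ := hH
  refine ⟨v₁ + u₂ - v₂ - w (k + 1), Set.sub_mem_sub (Set.sub_mem_sub (Set.add_mem_add hv₁ hu₂) hv₂)
    (hT.w_mem (k + 1)), ?_⟩
  have hz := hT.norm_weightedAvg_sub_gradient_le ha hL hk hk'
  have hw := hL.r₂.norm_sub_le p.r₂_ne_bot hk hk' (hT.w_mem k) (hT.w_mem (k + 1))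
  set Y := weightedAvg a k fun i => gradient (fun y => p.h y (σ i)) (x (k + 1))
  calc ‖v₁ + u₂ - v₂ - w (k + 1)‖
      = ‖-(u₁ - v₁) + (Y - v₂) + ((weightedAvg a k (z k) - Y) + (w k - w (k + 1)))‖ := by
        rw [eq_sub_of_add_eq' hu]
        congr 1
        abel
    _ ≤ ε₁ + ε₂ + ((L / 2 : ℝ≥0) * ‖x k - x (k + 1)‖ + (L / 2 : ℝ≥0) * ‖x k - x (k + 1)‖) :=
        norm_add_le_of_le (norm_add_le_of_le ((norm_neg _).trans_le hε₁) hε₂)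
          (norm_add_le_of_le hz hw)
    _ = ε₁ + ε₂ + L * ‖x (k + 1) - x k‖ := by
        rw [norm_sub_rev, NNReal.coe_div, NNReal.coe_two]
        ring

end IsTrajectory

end Program

end Residual

section Rate

lemma lintegral_infEDist_zero_le {V Ω' : Type*} [NormedAddCommGroup V] [MeasurableSpace Ω']
    {μ : Measure Ω'} {S : Ω' → Set V} {F : Ω' → ℝ} (hF : Integrable F μ)
    (hS : ∀ᵐ ω ∂μ, ∃ v ∈ S ω, ‖v‖ ≤ F ω) :
    ∫⁻ ω, Metric.infEDist 0 (S ω) ∂μ ≤ ENNReal.ofReal (∫ ω, F ω ∂μ) := by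
  have hF₀ : 0 ≤ᵐ[μ] F := hS.mono fun ω ⟨v, _, hle⟩ => (norm_nonneg v).trans hle
  rw [ofReal_integral_eq_lintegral_ofReal hF hF₀]
  refine lintegral_mono_ae (hS.mono fun ω ⟨v, hv, hle⟩ => ?_)
  refine (Metric.infEDist_le_edist_of_mem hv).trans ?_
  rw [edist_dist, dist_zero_left]
  exact ENNReal.ofReal_le_ofReal hle

lemma sq_integral_norm_le {V Ω' : Type*} [NormedAddCommGroup V] [MeasurableSpace Ω']
    {μ : Measure Ω'} [IsProbabilityMeasure μ] {f : Ω' → V} (hf : MemLp f 2 μ) :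
    (∫ ω, ‖f ω‖ ∂μ) ^ 2 ≤ ∫ ω, ‖f ω‖ ^ 2 ∂μ := by
  have hvar := variance_nonneg (fun ω => ‖f ω‖) μ
  rw [variance_eq_sub hf.norm] at hvar
  exact sub_nonneg.1 hvar

lemma sq_le_ofReal_of_forall_le {q : ℝ≥0∞} {e : ℕ → ℝ} {k : ℕ} (hk : k ≠ 0)
    (hq : ∀ i < k, q ≤ ENNReal.ofReal (e i)) :
    q ^ 2 ≤ ENNReal.ofReal (1 / k * ∑ i ∈ Finset.range k, e i ^ 2) := by
  have hsq : ∀ i ∈ Finset.range k, q ^ 2 ≤ ENNReal.ofReal (e i ^ 2) := fun i hi =>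
    calc q ^ 2 ≤ ENNReal.ofReal |e i| ^ 2 := by
          gcongr
          exact (hq i (Finset.mem_range.1 hi)).trans (ENNReal.ofReal_le_ofReal (le_abs_self _))
      _ = ENNReal.ofReal (e i ^ 2) := by rw [← ENNReal.ofReal_pow (abs_nonneg _), sq_abs]
  have hsum := Finset.sum_le_sum hsq
  rw [Finset.sum_const, Finset.card_range, nsmul_eq_mul,
    ← ENNReal.ofReal_sum_of_nonneg fun i _ => sq_nonneg _] at hsum
  rw [one_div_mul_eq_div, ENNReal.ofReal_div_of_pos (by positivity), ENNReal.ofReal_natCast]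
  rwa [ENNReal.le_div_iff_mul_le (by simp [hk]) (by simp), mul_comm]

namespace IsRun

variable {n : ℕ} {Ω : Type*} [MeasurableSpace Ω] {P : Measure Ω} {Ω' : Type*} [MeasurableSpace Ω']
  {μ : Measure Ω'} [IsProbabilityMeasure μ] {a : ℕ → ℝ} {s : ℕ → Ω' → Ω} {p : Program n P}
  {alg : Scheme} {x₀ : E n} {x : ℕ → Ω' → E n} {z : ℕ → ℕ → Ω' → E n} {w : ℕ → Ω' → E n}
  {C : Set (E n)} {L : ℝ≥0}

lemma memLp_step (hrun : IsRun p alg a μ x₀ s x z w) (hC : Bornology.IsBounded C)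
    (hxC : ∀ᵐ ω ∂μ, ∀ k, x k ω ∈ C) (k : ℕ) : MemLp (fun ω => x (k + 1) ω - x k ω) 2 μ := by
  have hmeas := (hrun.iterate_measurable (k + 1)).sub (hrun.iterate_measurable k)
  refine .of_bound hmeas.aestronglyMeasurable (Metric.diam C) (hxC.mono fun ω hω => ?_)
  rw [← dist_eq_norm]
  exact Metric.dist_le_diam_of_mem hC (hω _) (hω k)

lemma exists_sum_integral_step_sq_le (hrun : IsRun p alg a μ x₀ s x z w)
    (ha : SamplingWeights a) (hreg : p.Regular alg) (hopt : p.FiniteOptimalValue)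
    (hρ : 0 < p.modulus) (hC : IsCompact C) (hxC : ∀ᵐ ω ∂μ, ∀ k, x k ω ∈ C) :
    ∃ V, ∀ K, ∑ k ∈ Finset.range K, ∫ ω, ‖x (k + 1) ω - x k ω‖ ^ 2 ∂μ ≤ V := by
  have := hrun.isIIDSample.isProbabilityMeasure
  obtain ⟨ω₀, hω₀⟩ := hxC.exists
  obtain ⟨ρ, b, B, e, hρpos, he, -, hB, hdescent⟩ :=
    hrun.exists_surrogate_descent ha hreg hopt hρ hC ⟨_, hω₀ 0⟩
  obtain ⟨M, -, hM⟩ := hreg.exists_bound_sampled hC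
  have hstep : ∀ k, Integrable (fun ω => ‖x (k + 1) ω - x k ω‖ ^ 2) μ := fun k =>
    (hrun.memLp_step hC.isBounded hxC k).integrable_norm_pow two_ne_zero
  refine ⟨(p.realObjective x₀ + 2 * M - b + B) / ρ, fun K => (le_div_iff₀' hρpos).2 ?_⟩
  have hpath : ∀ᵐ ω ∂μ, ρ * ∑ k ∈ Finset.range K, ‖x (k + 1) ω - x k ω‖ ^ 2 ≤
      p.realObjective x₀ + 2 * M - b + ∑ k ∈ Finset.range K, e k ω := by
    filter_upwards [hxC, hdescent] with ω hxC hdescent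
    have hstart : p.surrogate alg a (fun i => s i ω) 0 (x 0 ω) ≤ p.realObjective x₀ + 2 * M := by
      have herr := abs_samplingError_le (P := P) ha.pos (hM _ (hxC 0)) (fun i => s i ω) 0
      rw [Program.surrogate, hrun.start_eq ω] at *
      linarith [neg_le_of_abs_le herr]
    have htele := Finset.sum_le_sum fun k (_ : k ∈ Finset.range K) => (hdescent hxC k).2
    have hsub := Finset.sum_range_sub
      (fun k => p.surrogate alg a (fun i => s i ω) k (x k ω)) K
    simp only [Finset.sum_add_distrib, Finset.sum_sub_distrib, ← Finset.mul_sum] at htele hsub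
    linarith [(hdescent hxC K).1]
  have hmono := integral_mono_ae ((integrable_finsetSum (Finset.range K) fun k _ =>
    hstep k).const_mul ρ) ((integrable_const _).add (integrable_finsetSum _ fun k _ => he k)) hpath
  rw [integral_const_mul, integral_finsetSum _ fun k _ => hstep k,
    integral_add' (integrable_const _) (integrable_finsetSum _ fun k _ => he k),
    integral_finsetSum _ fun k _ => he k, integral_const, probReal_univ, one_smul] at hmono
  linarith [hB K]

lemma exists_integral_subdiff_firstComponent_sub_le (hrun : IsRun p alg a μ x₀ s x z w)
    (ha : ∀ k, 0 < a k) (hreg : p.Regular alg) (hC : Bornology.IsBounded C)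
    (hL : p.EquiLipschitzGradients L C alg) :
    ∃ c : ℝ, ∀ k, ∃ Z : Ω' → ℝ, Integrable Z μ ∧
      (∀ ω, ∀ y ∈ C, ∀ u ∈ subdiff (ext (p.firstComponent a (fun i => s i ω) k alg)) y,
        ∃ v ∈ subdiff (ext p.G) y, ‖u - v‖ ≤ Z ω) ∧
      ∫ ω, Z ω ∂μ ≤ c * rate a k := by
  cases alg
  · exact ⟨0, fun k => ⟨0, integrable_zero _ _ _, fun ω y _ u hu => ⟨u, hu, by simp⟩, by simp⟩⟩
  · obtain ⟨c, hc⟩ := hrun.isIIDSample.exists_integral_weightedAvg_gradient_sub_le ha p.g_convex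
      p.g_continuous p.g_integrable hreg.1 hC hL.2.2
    refine ⟨c, fun k => (hc k).imp fun Z hZ => ⟨hZ.1, fun ω y hy u hu => ?_, hZ.2.2⟩⟩
    have hgrad := hasGradientAt_weightedAvg a k (φ := fun i v => p.g v (s i ω))
      fun i => ((hL.2.2 (s i ω)).1 y hy).2
    have hu_eq := eq_gradient_of_mem_subdiff (fun _ => EReal.coe_ne_bot _) hu
      (Eventually.of_forall fun _ => EReal.coe_ne_top _) hgrad.differentiableAt
    rw [hu_eq.trans hgrad.gradient]
    exact hZ.2.1 ω y hy

lemma exists_lintegral_infEDist_residual_le (hrun : IsRun p alg a μ x₀ s x z w)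
    (ha : ∀ k, 0 < a k) (hreg : p.Regular alg) (hC : Bornology.IsBounded C)
    (hxC : ∀ᵐ ω ∂μ, ∀ k, x k ω ∈ C) (hL : p.EquiLipschitzGradients L C alg) :
    ∃ c : ℝ, ∀ k, ∫⁻ ω, Metric.infEDist 0 (p.residual (x (k + 1) ω)) ∂μ ≤
      ENNReal.ofReal (c * rate a k + L * ∫ ω, ‖x (k + 1) ω - x k ω‖ ∂μ) := by
  obtain ⟨c₁, hc₁⟩ := hrun.exists_integral_subdiff_firstComponent_sub_le ha hreg hC hL
  obtain ⟨c₂, hc₂⟩ := hrun.isIIDSample.exists_integral_weightedAvg_gradient_sub_le ha p.h_convex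
    p.h_continuous p.h_integrable hreg.boundedEquicontinuous_h hC hL.h
  refine ⟨c₁ + c₂, fun k => ?_⟩
  obtain ⟨Z₁, hZ₁, hG, hle₁⟩ := hc₁ k
  obtain ⟨Z₂, hZ₂, hH, hle₂⟩ := hc₂ k
  have hstep := (((hrun.memLp_step hC hxC k).integrable one_le_two).norm.const_mul (L : ℝ))
  have hmem : ∀ᵐ ω ∂μ, ∃ v ∈ p.residual (x (k + 1) ω),
      ‖v‖ ≤ Z₁ ω + Z₂ ω + L * ‖x (k + 1) ω - x k ω‖ := by
    filter_upwards [hrun.ae_isTrajectory, hxC] with ω hT hxC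
    exact hT.exists_mem_residual_norm_le ha hL (hxC k) (hxC (k + 1)) (hG ω _ (hxC (k + 1)))
      (hH ω _ (hxC (k + 1)))
  refine (lintegral_infEDist_zero_le ((hZ₁.add hZ₂).add hstep) hmem).trans
    (ENNReal.ofReal_le_ofReal ?_)
  rw [integral_add' (hZ₁.add hZ₂) hstep, integral_add' hZ₁ hZ₂, integral_const_mul, add_mul]
  gcongr

lemma exists_criticalityGap_sq_le (hrun : IsRun p alg a μ x₀ s x z w) (ha : SamplingWeights a)
    (hreg : p.Regular alg) (hopt : p.FiniteOptimalValue) (hρ : 0 < p.modulus) (hC : IsCompact C)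
    (hxC : ∀ᵐ ω ∂μ, ∀ k, x k ω ∈ C) (hL : p.EquiLipschitzGradients L C alg) :
    ∃ c : ℝ, 0 ≤ c ∧ ∀ k ≠ 0, criticalityGap p μ x k ^ 2 ≤
      ENNReal.ofReal (c * (1 / k * ∑ i ∈ Finset.range k, rate a i ^ 2)) := by
  obtain ⟨V, hV⟩ := hrun.exists_sum_integral_step_sq_le ha hreg hopt hρ hC hxC
  obtain ⟨c, hc⟩ := hrun.exists_lintegral_infEDist_residual_le ha.pos hreg hC.isBounded hxC hL
  have hV₀ : 0 ≤ V := hV 0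
  have hr₀ : 0 < rate a 0 := rate_pos ha.pos 0
  refine ⟨2 * c ^ 2 + 2 * L ^ 2 * (V / rate a 0 ^ 2), by positivity, fun k hk => ?_⟩
  refine (sq_le_ofReal_of_forall_le hk fun i hi =>
    (iInf₂_le (i + 1) (Finset.mem_Icc.2 ⟨by lia, hi⟩)).trans (hc i)).trans
    (ENNReal.ofReal_le_ofReal ?_)
  rw [mul_left_comm]
  refine mul_le_mul_of_nonneg_left ?_ (by positivity)
  set S := ∑ i ∈ Finset.range k, rate a i ^ 2
  have hVS : V ≤ V / rate a 0 ^ 2 * S := by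
    have hS₀ : rate a 0 ^ 2 ≤ S := Finset.single_le_sum (f := fun i => rate a i ^ 2)
      (fun i _ => sq_nonneg _) (Finset.mem_range.2 (Nat.pos_of_ne_zero hk))
    rw [div_mul_eq_mul_div, le_div_iff₀ (by positivity)]
    exact mul_le_mul_of_nonneg_left hS₀ hV₀
  calc ∑ i ∈ Finset.range k, (c * rate a i + L * ∫ ω, ‖x (i + 1) ω - x i ω‖ ∂μ) ^ 2
      ≤ ∑ i ∈ Finset.range k, (2 * c ^ 2 * rate a i ^ 2 +
          2 * L ^ 2 * ∫ ω, ‖x (i + 1) ω - x i ω‖ ^ 2 ∂μ) := by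
        refine Finset.sum_le_sum fun i _ => add_sq_le.trans ?_
        rw [mul_pow, mul_pow, mul_add, ← mul_assoc, ← mul_assoc]
        gcongr
        exact sq_integral_norm_le (hrun.memLp_step hC.isBounded hxC i)
    _ = 2 * c ^ 2 * S + 2 * L ^ 2 * ∑ i ∈ Finset.range k, ∫ ω, ‖x (i + 1) ω - x i ω‖ ^ 2 ∂μ := by
        rw [Finset.sum_add_distrib, ← Finset.mul_sum, ← Finset.mul_sum]
    _ ≤ 2 * c ^ 2 * S + 2 * L ^ 2 * (V / rate a 0 ^ 2 * S) := by
        gcongr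
        exact (hV k).trans hVS
    _ = (2 * c ^ 2 + 2 * L ^ 2 * (V / rate a 0 ^ 2)) * S := by ring

end IsRun

lemma sum_Icc_one_eq_sum_range {V : Type*} [AddCommMonoid V] (f : ℕ → V) (k : ℕ) :
    ∑ i ∈ Finset.Icc 1 k, f (i - 1) = ∑ i ∈ Finset.range k, f i := by
  induction k with
  | zero => simp
  | succ k ih => simp [Finset.sum_Icc_succ_top, Finset.sum_range_succ, ih]

end Rate

section ConstantWeights

variable {a : ℕ → ℝ}

lemma rate_sq_le_of_eq_one (h : ∀ k, a k = 1) (i : ℕ) :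
    rate a i ^ 2 ≤ (2 + Real.log (i + 1)) * ((i : ℝ) + 1)⁻¹ := by
  have hlog : 0 ≤ Real.log (i + 1) := Real.log_nonneg (by simp)
  rw [rate, beta_of_eq_one h, div_pow, Real.sq_sqrt (by positivity), div_eq_mul_inv]
  rw [Real.log_sqrt (by positivity)]
  gcongr
  refine add_sq_le.trans_eq ?_
  rw [Real.sq_sqrt (by positivity)]
  ring

lemma sum_rate_sq_le_of_eq_one (h : ∀ k, a k = 1) {k : ℕ} (hk : 3 ≤ k) :
    ∑ i ∈ Finset.range k, rate a i ^ 2 ≤ 6 * Real.log k ^ 2 := by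
  have hk₀ : (0 : ℝ) < k := by positivity
  have hlog : 1 ≤ Real.log k := by
    rw [Real.le_log_iff_exp_le hk₀]
    have : (3 : ℝ) ≤ k := by exact_mod_cast hk
    linarith [Real.exp_one_lt_d9]
  have hharmonic : ∑ i ∈ Finset.range k, ((i : ℝ) + 1)⁻¹ ≤ 1 + Real.log k := by
    simpa [harmonic] using harmonic_le_one_add_log k
  calc ∑ i ∈ Finset.range k, rate a i ^ 2
      ≤ ∑ i ∈ Finset.range k, (2 + Real.log k) * ((i : ℝ) + 1)⁻¹ := by
        refine Finset.sum_le_sum fun i hi => (rate_sq_le_of_eq_one h i).trans ?_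
        gcongr
        exact_mod_cast Finset.mem_range.1 hi
    _ = (2 + Real.log k) * ∑ i ∈ Finset.range k, ((i : ℝ) + 1)⁻¹ := by rw [Finset.mul_sum]
    _ ≤ (2 + Real.log k) * (1 + Real.log k) := by gcongr
    _ ≤ 6 * Real.log k ^ 2 := by nlinarith

lemma le_ofReal_log_div_sqrt (h : ∀ k, a k = 1) {k : ℕ} (hk : 3 ≤ k) {q : ℝ≥0∞} {c : ℝ}
    (hc : 0 ≤ c)
    (hq : q ^ 2 ≤ ENNReal.ofReal (c * (1 / k * ∑ i ∈ Finset.range k, rate a i ^ 2))) :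
    q ≤ ENNReal.ofReal (√(6 * c) * (Real.log k / √k)) := by
  rw [← ENNReal.pow_le_pow_left_iff two_ne_zero, ← ENNReal.ofReal_pow (by positivity)]
  refine hq.trans (ENNReal.ofReal_le_ofReal ?_)
  calc c * (1 / k * ∑ i ∈ Finset.range k, rate a i ^ 2)
      ≤ c * (1 / k * (6 * Real.log k ^ 2)) := by
        gcongr
        exact sum_rate_sq_le_of_eq_one h hk
    _ = (√(6 * c) * (Real.log k / √k)) ^ 2 := by
        rw [mul_pow, div_pow, Real.sq_sqrt (by positivity), Real.sq_sqrt (Nat.cast_nonneg k)]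
        ring

end ConstantWeights

end SDC

end

theorem mainTheorem2_general {n : ℕ} {Ω : Type*} [MeasurableSpace Ω] (P : Measure Ω)
    [IsProbabilityMeasure P] (p : SDC.Program n P)
    {Ω' : Type*} [MeasurableSpace Ω'] (μ : Measure Ω') [IsProbabilityMeasure μ]
    (a : ℕ → ℝ) (ha : SDC.SamplingWeights a)
    (alg : SDC.Scheme) (hreg : p.Regular alg)
    (x₀ : SDC.E n) (s : ℕ → Ω' → Ω) (x : ℕ → Ω' → SDC.E n)
    (z : ℕ → ℕ → Ω' → SDC.E n) (w : ℕ → Ω' → SDC.E n)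
    (hrun : SDC.IsRun p alg a μ x₀ s x z w)
    (hopt : p.FiniteOptimalValue)
    (hbdd : ∀ᵐ ω ∂μ, BddAbove (Set.range fun k => ‖x k ω‖))
    (hρ : 0 < p.modulus) :
    ((∀ᵐ ω ∂μ, ∃ l : ℝ, Tendsto (fun k => p.objective (x k ω)) atTop (𝓝 (l : EReal))) ∧
      (∀ᵐ ω ∂μ, Summable fun k => ‖x (k + 1) ω - x k ω‖ ^ 2) ∧
      (∀ᵐ ω ∂μ, BddAbove (Set.range fun k => ‖w k ω‖) →
        ∀ y : SDC.E n, MapClusterPt y atTop (fun k => x k ω) → p.IsCritical y)) ∧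
    (∀ (C : Set (SDC.E n)) (L : ℝ≥0), IsCompact C → (∀ᵐ ω ∂μ, ∀ k, x k ω ∈ C) →
      p.EquiLipschitzGradients L C alg →
      (∃ c : ℝ, ∀ᶠ k : ℕ in atTop,
        SDC.criticalityGap p μ x k ^ 2 ≤ ENNReal.ofReal (c * (1 / (k : ℝ) *
          ∑ i ∈ Finset.Icc 1 k,
            (1 + Real.sqrt (Real.log (SDC.beta a (i - 1)))) ^ 2 / SDC.beta a (i - 1) ^ 2))) ∧
      ((∀ k, a k = 1) →
        ∃ c : ℝ, ∀ᶠ k : ℕ in atTop,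
          SDC.criticalityGap p μ x k ≤
            ENNReal.ofReal (c * (Real.log k / Real.sqrt k)))) := by
  have hconv := hrun.ae_tendsto_and_summable ha hreg hopt hbdd hρ
  refine ⟨⟨hconv.mono fun ω h => h.1, hconv.mono fun ω h => h.2,
    hrun.ae_isCritical ha hreg hbdd (hconv.mono fun ω h => h.2)⟩, fun C L hC hxC hL => ?_⟩
  obtain ⟨c, hc, hgap⟩ := hrun.exists_criticalityGap_sq_le ha hreg hopt hρ hC hxC hL
  refine ⟨⟨c, ?_⟩, fun hone => ⟨√(6 * c), ?_⟩⟩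
  · filter_upwards [eventually_ne_atTop 0] with k hk
    simpa only [← SDC.sum_Icc_one_eq_sum_range, SDC.rate, div_pow] using hgap k hk
  · filter_upwards [eventually_ge_atTop 3] with k hk
    exact SDC.le_ofReal_log_div_sqrt hone hk hc (hgap k (by lia))

theorem mainTheorem2 {n : ℕ} {Ω : Type*} [MeasurableSpace Ω] (P : Measure Ω)
    [IsProbabilityMeasure P] (p : SDC.Program n P)
    {Ω' : Type*} [MeasurableSpace Ω'] (μ : Measure Ω') [IsProbabilityMeasure μ]
    (a : ℕ → ℝ) (ha : SDC.AdmissibleWeights a)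
    (alg : SDC.Scheme) (hreg : p.Regular alg)
    (x₀ : SDC.E n) (s : ℕ → Ω' → Ω) (x : ℕ → Ω' → SDC.E n)
    (z : ℕ → ℕ → Ω' → SDC.E n) (w : ℕ → Ω' → SDC.E n)
    (hrun : SDC.IsRun p alg a μ x₀ s x z w)
    (hopt : p.FiniteOptimalValue)
    (hbdd : ∀ᵐ ω ∂μ, BddAbove (Set.range fun k => ‖x k ω‖))
    (hρ : 0 < p.modulus) :
    -- (i)
    ((∀ᵐ ω ∂μ, ∃ l : ℝ, Tendsto (fun k => p.objective (x k ω)) atTop (𝓝 (l : EReal))) ∧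
      (∀ᵐ ω ∂μ, Summable fun k => ‖x (k + 1) ω - x k ω‖ ^ 2) ∧
      (∀ᵐ ω ∂μ, BddAbove (Set.range fun k => ‖w k ω‖) →
        ∀ y : SDC.E n, MapClusterPt y atTop (fun k => x k ω) → p.IsCritical y)) ∧
    -- (ii)
    (∀ (C : Set (SDC.E n)) (L : ℝ≥0), IsCompact C → (∀ᵐ ω ∂μ, ∀ k, x k ω ∈ C) →
      p.EquiLipschitzGradients L C alg →
      (∃ c : ℝ, ∀ᶠ k : ℕ in atTop,
        SDC.criticalityGap p μ x k ^ 2 ≤ ENNReal.ofReal (c * (1 / (k : ℝ) *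
          ∑ i ∈ Finset.Icc 1 k,
            (1 + Real.sqrt (Real.log (SDC.beta a (i - 1)))) ^ 2 / SDC.beta a (i - 1) ^ 2))) ∧
      ((∀ k, a k = 1) →
        ∃ c : ℝ, ∀ᶠ k : ℕ in atTop,
          SDC.criticalityGap p μ x k ≤
            ENNReal.ofReal (c * (Real.log k / Real.sqrt k)))) :=
  mainTheorem2_general P p μ a ha.samplingWeights alg hreg x₀ s x z w hrun hopt hbdd hρ
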